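/- **Setting.** Let $f,g\in C^2(\mathbb R)$, let $\sigma,\alpha>0$ and $c\in\mathbb R$, put $a=f'(0)$, $b=g'(0)$, and assume $$a+b<0,\qquad ab+\sigma\alpha>0 .$$ Let $\varphi=(\hat u,\hat v)$ be a traveling wave of $u_t=u_{xx}+f(u)-\sigma v$, $v_t=v_{xx}+g(v)+\alpha u$, that is, a $C^2$ solution on $\mathbb R$ of $$\hat u''+c\hat u'+f(\hat u)-\sigma\hat v=0,\qquad \hat v''+c\hat v'+g(\hat v)+\alpha\hat u=0,$$ in the variable $z=x-ct$, with $\hat u(z),\hat v(z)\to 0$ exponentially as $z\to\pm\infty$. Let $BU$ be the Banach space of bounded, uniformly continuous functions $\mathbb R\to\mathbb C^2$ with the supremum norm, and let $L$ be the operator in $BU$ $$LP=P''+cP'+\begin{pmatrix} f'(\hat u)&-\sigma\\ \alpha& g'(\hat v)\end{pmatrix}P,\qquad P,P',P''\in BU .$$ The essential spectrum $\sigma_{\rm ess}(L)$ is the complement in the spectrum $\sigma(L)$ of the set of isolated points of $\sigma(L)$ that are eigenvalues $\lambda$ of finite algebraic multiplicity (the dimension of $\bigcup_n\ker (L-\lambda)^n$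 is finite) and for which the range of $L-\lambda$ has finite codimension. For $\lambda\in\mathbb C$ let $$A_\infty(\lambda)=\begin{pmatrix}0&0&\sigma&0\\0&0&0&\alpha\\ \frac{\lambda-a}{\sigma}&1&-c&0\\-1&\frac{\lambda-b}{\alpha}&0&-c\end{pmatrix}.$$ **Lemma 2.1.** There is $K<0$ such that $$\sigma_{\rm ess}(L)\subset\mathcal K:=\{z\in\mathbb C:\operatorname{Re}z\le K\},$$ and for every $\lambda\in\mathbb C\setminus\mathcal K$ the matrix $A_\infty(\lambda)$ has, counted with algebraic multiplicity, exactly two eigenvalues of positive real part and exactly two of negative real part. -/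

import Mathlib

open scoped BoundedContinuousFunction

/-! ### Spectral notions for an unbounded operator with its domain -/

section Spectral

variable {X : Type*} [NormedAddCommGroup X] [NormedSpace ℂ X]

/-- The operator `T - l`, as a linear map on the domain of `T`. -/
def shiftedOperator (T : X →ₗ.[ℂ] X) (l : ℂ) : T.domain →ₗ[ℂ] X :=
  T.toFun - l • T.domain.subtype

/-- The resolvent set of `T`: the `l` for which `T - l` has a bounded two-sided inverse,
defined on the whole space and with values in the domain of `T`. -/
def resolventSetOp (T : X →ₗ.[ℂ] X) : Set ℂ :=
  {l | ∃ R : X →L[ℂ] X,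
    (∀ x : X, ∃ h : R x ∈ T.domain, shiftedOperator T l ⟨R x, h⟩ = x) ∧
    ∀ y : T.domain, R (shiftedOperator T l y) = y}

/-- The spectrum of `T`. -/
def spectrumOp (T : X →ₗ.[ℂ] X) : Set ℂ := (resolventSetOp T)ᶜ

/-- `l` is an eigenvalue of `T`: the equation `T x = l x` has a nonzero solution in the domain. -/
def IsEigenvalueOp (T : X →ₗ.[ℂ] X) (l : ℂ) : Prop :=
  ∃ x : T.domain, x ≠ 0 ∧ T x = l • (x : X)

/-- The kernel of `(T - l) ^ n`, with the natural domain of the power. -/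
def genKer (T : X →ₗ.[ℂ] X) (l : ℂ) : ℕ → Submodule ℂ X
  | 0 => ⊥
  | n + 1 => ((genKer T l n).comap (shiftedOperator T l)).map T.domain.subtype

/-- The generalized eigenspace of `T` at `l`: the union of the kernels of `(T - l) ^ n`.
Its dimension is the algebraic multiplicity of `l`. -/
def genEigenspaceOp (T : X →ₗ.[ℂ] X) (l : ℂ) : Submodule ℂ X := ⨆ n, genKer T l n

/-- The point spectrum (normal eigenvalues): the eigenvalues that are isolated points of the
spectrum, whose algebraic multiplicity is finite, and for which `T - l` has a range of finite
codimension. For a closed operator these are the isolated points of the spectrum whose Riesz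
projection has finite rank. -/
def pointSpectrumOp (T : X →ₗ.[ℂ] X) : Set ℂ :=
  {l | IsEigenvalueOp T l ∧
    (∃ r : ℝ, 0 < r ∧ ∀ m ∈ spectrumOp T, ‖m - l‖ < r → m = l) ∧
    FiniteDimensional ℂ (genEigenspaceOp T l) ∧
    FiniteDimensional ℂ (X ⧸ LinearMap.range (shiftedOperator T l))}

/-- The essential spectrum: the complement of the point spectrum in the spectrum. -/
def essentialSpectrumOp (T : X →ₗ.[ℂ] X) : Set ℂ := spectrumOp T \ pointSpectrumOp T

end Spectral

/-! ### The traveling wave and the operator obtained by linearizing about it -/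

/-- `(u, v)` is the profile, in the variable `z = x - c t`, of a traveling wave of
`u_t = u_xx + f(u) - σ v`, `v_t = v_xx + g(v) + α u`
that decays exponentially to `(0, 0)` as `z → ±∞`. -/
structure IsTravelingWave (f g : ℝ → ℝ) (σ α c : ℝ) (u v : ℝ → ℝ) : Prop where
  contDiff_u : ContDiff ℝ 2 u
  contDiff_v : ContDiff ℝ 2 v
  eq_u : ∀ z, deriv (deriv u) z + c * deriv u z + f (u z) - σ * v z = 0
  eq_v : ∀ z, deriv (deriv v) z + c * deriv v z + g (v z) + α * u z = 0
  decay : ∃ C η : ℝ, 0 < η ∧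
    ∀ z, |u z| ≤ C * Real.exp (-η * |z|) ∧ |v z| ≤ C * Real.exp (-η * |z|)

/-- The space of bounded, uniformly continuous functions `ℝ → ℂ²` with the supremum norm. -/
noncomputable def BU : Submodule ℂ (ℝ →ᵇ ℂ × ℂ) where
  carrier := {P | UniformContinuous P}
  add_mem' {P Q} hP hQ := UniformContinuous.add (f := P) (g := Q) hP hQ
  zero_mem' := uniformContinuous_const
  smul_mem' a P hP := UniformContinuous.const_smul (f := P) hP a

/-- The value at `z` of a function in `BU`. -/
noncomputable def evalBU (P : BU) (z : ℝ) : ℂ × ℂ := (P : ℝ →ᵇ ℂ × ℂ) z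

/-- The Jacobian matrix of the reaction terms at the point `(u, v)`,
`[[f'(u), -σ], [α, g'(v)]]`, acting on `ℂ²`. -/
noncomputable def jacobianAction (f g : ℝ → ℝ) (σ α u v : ℝ) (w : ℂ × ℂ) : ℂ × ℂ :=
  (((deriv f u : ℝ) : ℂ) * w.1 - (σ : ℂ) * w.2, (α : ℂ) * w.1 + ((deriv g v : ℝ) : ℂ) * w.2)

/-- The graph of the linearized operator: the pairs `(P, Q)` in `BU × BU` such that `P` is twice
differentiable with `P', P''` in `BU`, and `Q = P'' + c P' + DF(u, v) P`. -/
def linearizationGraph (f g : ℝ → ℝ) (σ α c : ℝ) (u v : ℝ → ℝ) : Submodule ℂ (BU × BU) where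
  carrier := {PQ | ∃ P₁ P₂ : BU,
    (∀ z, HasDerivAt (evalBU PQ.1) (evalBU P₁ z) z) ∧
    (∀ z, HasDerivAt (evalBU P₁) (evalBU P₂ z) z) ∧
    ∀ z, evalBU PQ.2 z =
      evalBU P₂ z + (c : ℂ) • evalBU P₁ z + jacobianAction f g σ α (u z) (v z) (evalBU PQ.1 z)}
  add_mem' := by
    rintro ⟨P, Q⟩ ⟨P', Q'⟩ ⟨P₁, P₂, h1, h2, h3⟩ ⟨P₁', P₂', h1', h2', h3'⟩
    refine ⟨P₁ + P₁', P₂ + P₂', fun z => (h1 z).add (h1' z), fun z => (h2 z).add (h2' z), ?_⟩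
    intro z
    have e : evalBU ((P, Q) + (P', Q')).2 z = evalBU Q z + evalBU Q' z := rfl
    have e1 : evalBU (P₂ + P₂') z = evalBU P₂ z + evalBU P₂' z := rfl
    have e2 : evalBU (P₁ + P₁') z = evalBU P₁ z + evalBU P₁' z := rfl
    have e3 : evalBU ((P, Q) + (P', Q')).1 z = evalBU P z + evalBU P' z := rfl
    rw [e, e1, e2, e3, h3 z, h3' z]
    ext <;> simp [jacobianAction] <;> ring
  zero_mem' := by
    refine ⟨0, 0, fun z => hasDerivAt_const z (0 : ℂ × ℂ),
      fun z => hasDerivAt_const z (0 : ℂ × ℂ), fun z => ?_⟩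
    have e (z : ℝ) : evalBU (0 : BU) z = 0 := rfl
    ext <;> simp [jacobianAction, e]
  smul_mem' := by
    rintro a ⟨P, Q⟩ ⟨P₁, P₂, h1, h2, h3⟩
    refine ⟨a • P₁, a • P₂, fun z => (h1 z).const_smul a, fun z => (h2 z).const_smul a, ?_⟩
    intro z
    have e : evalBU (a • (P, Q)).2 z = a • evalBU Q z := rfl
    have e1 : evalBU (a • P₂) z = a • evalBU P₂ z := rfl
    have e2 : evalBU (a • P₁) z = a • evalBU P₁ z := rfl
    have e3 : evalBU (a • (P, Q)).1 z = a • evalBU P z := rfl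
    rw [e, e1, e2, e3, h3 z]
    ext <;> simp [jacobianAction] <;> ring

/-- The operator `L P = P'' + c P' + DF(u, v) P` in `BU`, on its natural domain of the `P` with
`P', P''` (and `L P`, which is automatic for a traveling wave) in `BU`. -/
noncomputable def linearizedOperator (f g : ℝ → ℝ) (σ α c : ℝ) (u v : ℝ → ℝ) : BU →ₗ.[ℂ] BU :=
  (linearizationGraph f g σ α c u v).toLinearPMap

/-- The linearization graph is single valued, so that it is the graph of the operator. -/
theorem linearizedOperator_graph (f g : ℝ → ℝ) (σ α c : ℝ) (u v : ℝ → ℝ) :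
    (linearizedOperator f g σ α c u v).graph = linearizationGraph f g σ α c u v := by
  refine Submodule.toLinearPMap_graph_eq _ ?_
  rintro ⟨P, Q⟩ ⟨P₁, P₂, h1, h2, h3⟩ (h0 : P = 0)
  subst h0
  have e1 (z : ℝ) : evalBU P₁ z = 0 :=
    (h1 z).unique (hasDerivAt_const z (0 : ℂ × ℂ))
  have e1' : evalBU P₁ = fun _ => 0 := funext e1
  have e2 (z : ℝ) : evalBU P₂ z = 0 := by
    have := h2 z
    rw [e1'] at this
    exact this.unique (hasDerivAt_const z (0 : ℂ × ℂ))
  have e0 (z : ℝ) : evalBU (0 : BU) z = 0 := rfl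
  apply Subtype.ext
  ext1 z
  have := h3 z
  simp only [e1 z, e2 z, e0 z] at this
  change evalBU Q z = 0
  rw [this]
  simp [jacobianAction]

/-- The limit as `z → ±∞` of the coefficient matrix of the eigenvalue equation `L P = l P`,
written as a first-order system for `(p, q, p' / σ, q' / α)`; here `a = f'(0)`, `b = g'(0)`. -/
noncomputable def asymptoticMatrix (a b σ α c : ℝ) (l : ℂ) : Matrix (Fin 4) (Fin 4) ℂ :=
  !![0, 0, (σ : ℂ), 0;
     0, 0, 0, (α : ℂ);
     l / σ - a / σ, 1, -(c : ℂ), 0;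
     -1, l / α - b / α, 0, -(c : ℂ)]

open Classical in
/-- The number of eigenvalues of `A` in `S`, counted with algebraic multiplicity. -/
noncomputable def eigenvalueCount {n : ℕ} (A : Matrix (Fin n) (Fin n) ℂ) (S : Set ℂ) : ℕ :=
  (A.charpoly.roots.filter (· ∈ S)).card

/-! Let `μ₁`, `μ₂` be the eigenvalues of the rest-state Jacobian `[[a, -σ], [α, b]]`. Its trace is
negative and its determinant positive, so both lie in the open left half-plane, and `K = max μ₁.re
μ₂.re` works. The characteristic polynomial of the asymptotic matrix is the product of the
quadratics `t² + c t - (l - μᵢ)`. Since `c` is real, each has one root on either side of the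
imaginary axis once `Re l > Re μᵢ`.

The same splitting inverts the constant-coefficient operator on `BU` by exponential integrals
(`exists_inverse_asymptotic`). This inverse produces Lipschitz functions, and the linearization
about the wave differs from the constant-coefficient operator by multiplication by a matrix that
decays at infinity. The inverse followed by this multiplication is therefore a norm limit of
finite-rank operators (`exists_finiteRank_approx`), and a Neumann series makes `L - l - J Φ`
invertible for some `J Φ` of finite rank.

With `G` the inverse, `l` is a resolvent point iff `det (1 + Φ G J) ≠ 0`, and this determinant
continues analytically near `l`. The half-plane is connected and contains resolvent points
(`exists_gt_mem_resolventSetOp`), so the zeros are isolated. Each zero is a normal eigenvalue: the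
cokernel is finite-dimensional because `J Φ` has finite rank, and the order of the zero bounds the
length of nondegenerate Jordan chains (`chain_one_eq_zero`). This is `disjoint_essentialSpectrumOp`.
-/

open Filter Topology

/-! ### Bounded perturbations of an unbounded operator, and Jordan chains. -/

section AbstractSpectral

variable {X : Type*} [NormedAddCommGroup X] [NormedSpace ℂ X]

/-- `R` is a bounded two-sided inverse of `T + A`, where `A` is bounded. -/
def IsInverseOfAdd (T : X →ₗ.[ℂ] X) (A R : X →L[ℂ] X) : Prop :=
  (∀ x, (R x, x - A (R x)) ∈ T.graph) ∧ ∀ p ∈ T.graph, R (p.2 + A p.1) = p.1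

/-- The bounded operator `-l - A`. -/
noncomputable def shiftSub (A : X →L[ℂ] X) (l : ℂ) : X →L[ℂ] X :=
  -(l • ContinuousLinearMap.id ℂ X) - A

theorem shiftSub_apply (A : X →L[ℂ] X) (l : ℂ) (x : X) :
    shiftSub A l x = -(l • x) - A x := rfl

theorem shiftSub_zero (l : ℂ) :
    shiftSub (0 : X →L[ℂ] X) l = -(l • ContinuousLinearMap.id ℂ X) := sub_zero _

theorem mem_resolventSetOp_iff {T : X →ₗ.[ℂ] X} {l : ℂ} :
    l ∈ resolventSetOp T ↔ ∃ R, IsInverseOfAdd T (-(l • ContinuousLinearMap.id ℂ X)) R := by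
  constructor
  · rintro ⟨R, h1, h2⟩
    refine ⟨R, fun x => ?_, ?_⟩
    · obtain ⟨h, hx⟩ := h1 x
      rw [LinearPMap.mem_graph_iff]
      refine ⟨⟨R x, h⟩, rfl, ?_⟩
      have hx' : T ⟨R x, h⟩ - l • R x = x := hx
      simp only [neg_apply, smul_apply, ContinuousLinearMap.id_apply, sub_neg_eq_add]
      rw [← sub_eq_iff_eq_add]; exact hx'
    · rintro ⟨p, q⟩ hp
      obtain ⟨y, hy1, hy2⟩ := (LinearPMap.mem_graph_iff T).1 hp
      simp only at hy1 hy2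
      have := h2 y
      subst hy1 hy2
      exact (congrArg R (sub_eq_add_neg (T y) (l • (y : X))).symm).trans this
  · rintro ⟨R, h1, h2⟩
    refine ⟨R, fun x => ?_, fun y => ?_⟩
    · obtain ⟨y, hy1, hy2⟩ := (LinearPMap.mem_graph_iff T).1 (h1 x)
      simp only at hy1 hy2
      have h : R x ∈ T.domain := hy1 ▸ y.2
      refine ⟨h, ?_⟩
      have hy : y = ⟨R x, h⟩ := Subtype.ext hy1
      subst hy
      change T ⟨R x, h⟩ - l • R x = x
      rw [hy2]; simp
    · exact (congrArg R (sub_eq_add_neg (T y) (l • (y : X)))).trans (h2 _ (T.mem_graph y))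

/-- On the domain `T + A' = (1 + (A' - A) R)(T + A)`, so a two-sided inverse `E` of the first factor
suffices. `E` comes from a Neumann series or from a finite matrix. -/
theorem IsInverseOfAdd.perturb {T : X →ₗ.[ℂ] X} {A R A' E : X →L[ℂ] X}
    (h : IsInverseOfAdd T A R) (h1 : ∀ x, E x + (A' - A) (R (E x)) = x)
    (h2 : ∀ x, E (x + (A' - A) (R x)) = x) : IsInverseOfAdd T A' (R ∘L E) := by
  refine ⟨fun x => ?_, fun p hp => ?_⟩
  · have h1x := h1 x
    simp only [sub_apply] at h1x
    have e : x - A' (R (E x)) = E x - A (R (E x)) := by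
      nth_rewrite 1 [← h1x]
      abel
    simp only [ContinuousLinearMap.comp_apply]
    rw [e]
    exact h.1 (E x)
  · have hR := h.2 p hp
    have := h2 (p.2 + A p.1)
    rw [hR] at this
    simp only [sub_apply] at this
    simp only [ContinuousLinearMap.comp_apply]
    rw [show p.2 + A' p.1 = p.2 + A p.1 + (A' p.1 - A p.1) by abel, this, hR]

theorem IsInverseOfAdd.perturb_of_isUnit {T : X →ₗ.[ℂ] X} {A R A' : X →L[ℂ] X}
    (h : IsInverseOfAdd T A R) (hu : IsUnit (1 + (A' - A) * R)) :
    IsInverseOfAdd T A' (R * Ring.inverse (1 + (A' - A) * R)) := by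
  refine h.perturb (fun x => ?_) (fun x => ?_)
  · have := Ring.mul_inverse_cancel _ hu
    exact congrArg (fun B : X →L[ℂ] X => B x) this
  · have := Ring.inverse_mul_cancel _ hu
    exact congrArg (fun B : X →L[ℂ] X => B x) this

theorem IsInverseOfAdd.exists_of_norm_lt_one [CompleteSpace X] {T : X →ₗ.[ℂ] X}
    {A R A' : X →L[ℂ] X} (h : IsInverseOfAdd T A R) (hn : ‖(A' - A) * R‖ < 1) :
    ∃ R', IsInverseOfAdd T A' R' := by
  refine ⟨_, h.perturb_of_isUnit ?_⟩
  have := isUnit_one_sub_of_norm_lt_one (x := -((A' - A) * R)) (by rwa [norm_neg])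
  rwa [sub_neg_eq_add] at this

theorem IsInverseOfAdd.exists_of_sub_le [CompleteSpace X] {T : X →ₗ.[ℂ] X} {A A' R : X →L[ℂ] X}
    {l : ℂ} (h : IsInverseOfAdd T (shiftSub A l) R) {k : ℝ} (hk0 : 0 ≤ k) (hk : k < 1)
    (hle : ∀ x, ‖A (R x) - A' (R x)‖ ≤ k * ‖x‖) : ∃ R', IsInverseOfAdd T (shiftSub A' l) R' := by
  refine h.exists_of_norm_lt_one (lt_of_le_of_lt
    (ContinuousLinearMap.opNorm_le_bound _ hk0 fun x => ?_) hk)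
  have e : ((shiftSub A' l - shiftSub A l) * R) x = A (R x) - A' (R x) := by
    rw [mul_apply_eq_comp, sub_apply, shiftSub_apply, shiftSub_apply]
    abel
  rw [e]
  exact hle x

theorem mem_genKer_succ {T : X →ₗ.[ℂ] X} {l : ℂ} {n : ℕ} {x : X} :
    x ∈ genKer T l (n + 1) ↔ ∃ y ∈ genKer T l n, (x, y + l • x) ∈ T.graph := by
  constructor
  · rintro ⟨y, hy, rfl⟩
    refine ⟨_, hy, ?_⟩
    rw [LinearPMap.mem_graph_iff]
    refine ⟨y, rfl, ?_⟩
    change T y = (T y - l • (y : X)) + l • (y : X)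
    abel
  · rintro ⟨y, hy, hxy⟩
    obtain ⟨z, hz1, hz2⟩ := (LinearPMap.mem_graph_iff T).1 hxy
    simp only at hz1 hz2
    refine ⟨z, ?_, hz1⟩
    change T z - l • (z : X) ∈ genKer T l n
    rw [hz2, hz1]
    simpa using hy

theorem genKer_mono_succ (T : X →ₗ.[ℂ] X) (l : ℂ) (n : ℕ) :
    genKer T l n ≤ genKer T l (n + 1) := by
  induction n with
  | zero => exact bot_le
  | succ n ih =>
    intro x hx
    obtain ⟨y, hy, hxy⟩ := mem_genKer_succ.1 hx
    exact mem_genKer_succ.2 ⟨y, ih hy, hxy⟩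

/-- Jordan chains of `T` at `l`. -/
theorem exists_chain_of_mem_genKer {T : X →ₗ.[ℂ] X} {l : ℂ} {n : ℕ} {x : X}
    (hx : x ∈ genKer T l n) :
    ∃ χ : ℕ → X, χ 0 = 0 ∧ χ n = x ∧ ∀ k < n, (χ (k + 1), χ k + l • χ (k + 1)) ∈ T.graph := by
  induction n generalizing x with
  | zero =>
    have : x = 0 := hx
    exact ⟨fun _ => 0, rfl, this.symm, fun k hk => absurd hk (Nat.not_lt_zero k)⟩
  | succ n ih =>
    obtain ⟨y, hy, hxy⟩ := mem_genKer_succ.1 hx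
    obtain ⟨χ, h0, hn, hχ⟩ := ih hy
    refine ⟨Function.update χ (n + 1) x, by simp [h0], by simp, fun k hk => ?_⟩
    rcases Nat.lt_succ_iff_lt_or_eq.1 hk with hk | rfl
    · rw [Function.update_of_ne (by omega), Function.update_of_ne (by omega)]
      exact hχ k hk
    · rw [Function.update_self, Function.update_of_ne (by omega), hn]
      exact hxy

theorem mem_genKer_of_chain {T : X →ₗ.[ℂ] X} {l : ℂ} {χ : ℕ → X} {n : ℕ} (h0 : χ 0 = 0)
    (h : ∀ k < n, (χ (k + 1), χ k + l • χ (k + 1)) ∈ T.graph) : χ n ∈ genKer T l n := by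
  induction n with
  | zero => exact h0
  | succ n ih =>
    exact mem_genKer_succ.2 ⟨χ n, ih fun k hk => h k (by omega), h n (by omega)⟩

/-- The chain becomes a polynomial `y(z)` that is an approximate eigenvector at `z`: by telescoping,
`(T - z) y(z) = -(z - l)^n χ n`, a residual of order `n` at `l`. -/
theorem chain_sum_mem_graph {T : X →ₗ.[ℂ] X} {l : ℂ} {χ : ℕ → X} {n : ℕ} (h0 : χ 0 = 0)
    (h : ∀ k < n, (χ (k + 1), χ k + l • χ (k + 1)) ∈ T.graph) (z : ℂ) :
    (∑ k ∈ Finset.range n, (z - l) ^ k • χ (k + 1),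
      z • (∑ k ∈ Finset.range n, (z - l) ^ k • χ (k + 1)) - (z - l) ^ n • χ n) ∈ T.graph := by
  induction n with
  | zero => simp [h0]
  | succ n ih =>
    have h1 := ih fun k hk => h k (by omega)
    have h2 := T.graph.smul_mem ((z - l) ^ n) (h n (by omega))
    have := T.graph.add_mem h1 h2
    rw [Finset.sum_range_succ]
    convert this using 1
    simp only [Prod.smul_mk, Prod.mk_add_mk, Prod.mk.injEq, true_and]
    module

/-- The finite-dimensional reduction `1 + Φ G J`. -/
noncomputable def reducedMatrix {n : ℕ} (J : (Fin n → ℂ) →L[ℂ] X) (Φ : X →L[ℂ] (Fin n → ℂ))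
    (G : X →L[ℂ] X) : Matrix (Fin n) (Fin n) ℂ :=
  1 + LinearMap.toMatrix' ((Φ ∘L G ∘L J : (Fin n → ℂ) →L[ℂ] (Fin n → ℂ)) :
    (Fin n → ℂ) →ₗ[ℂ] (Fin n → ℂ))

/-! ### Reduction of `T - l` to an `n × n` matrix. -/

section Reduction

variable {T : X →ₗ.[ℂ] X} {n : ℕ} {J : (Fin n → ℂ) →L[ℂ] X} {Φ : X →L[ℂ] (Fin n → ℂ)}
  {G : X →L[ℂ] X} {l : ℂ}

theorem reducedMatrix_mulVec (v : Fin n → ℂ) :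
    (reducedMatrix J Φ G).mulVec v = v + Φ (G (J v)) := by
  rw [reducedMatrix, Matrix.add_mulVec, Matrix.one_mulVec, LinearMap.toMatrix'_mulVec]
  rfl

/-- The bounded perturbation `-l - J Φ`. -/
noncomputable abbrev shiftPerturbation (J : (Fin n → ℂ) →L[ℂ] X) (Φ : X →L[ℂ] (Fin n → ℂ))
    (l : ℂ) : X →L[ℂ] X := shiftSub (J ∘L Φ) l

theorem shiftPerturbation_apply (x : X) :
    shiftPerturbation J Φ l x = -(l • x) - J (Φ x) := rfl

/-- Here `T - l = (1 + J Φ G)(T - l - J Φ)`, and the first factor has the inverse `1 - J (1 + Φ G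
J)⁻¹ Φ G`. -/
theorem mem_resolventSetOp_of_det_ne_zero (h : IsInverseOfAdd T (shiftPerturbation J Φ l) G)
    (hd : (reducedMatrix J Φ G).det ≠ 0) : l ∈ resolventSetOp T := by
  rw [mem_resolventSetOp_iff]
  have hu : IsUnit (reducedMatrix J Φ G).det := isUnit_iff_ne_zero.2 hd
  set N := reducedMatrix J Φ G with hN
  let I : (Fin n → ℂ) →L[ℂ] (Fin n → ℂ) := (Matrix.mulVecLin N⁻¹).toContinuousLinearMap
  have hI1 (v : Fin n → ℂ) : I v + Φ (G (J (I v))) = v := by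
    rw [← reducedMatrix_mulVec]
    change N.mulVec (N⁻¹.mulVec v) = v
    rw [Matrix.mulVec_mulVec, Matrix.mul_nonsing_inv _ hu, Matrix.one_mulVec]
  have hI2 (v : Fin n → ℂ) : I (v + Φ (G (J v))) = v := by
    rw [← reducedMatrix_mulVec]
    change N⁻¹.mulVec (N.mulVec v) = v
    rw [Matrix.mulVec_mulVec, Matrix.nonsing_inv_mul _ hu, Matrix.one_mulVec]
  have hA (x : X) : (-(l • ContinuousLinearMap.id ℂ X) - shiftPerturbation J Φ l) x = J (Φ x) := by
    simp [shiftSub]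
  refine ⟨_, h.perturb (E := ContinuousLinearMap.id ℂ X - J ∘L I ∘L Φ ∘L G) ?_ ?_⟩
  · intro x
    rw [hA]
    have := hI1 (Φ (G x))
    simp only [sub_apply, ContinuousLinearMap.id_apply, ContinuousLinearMap.comp_apply, map_sub]
    have h2 := congrArg J this
    rw [map_add] at h2
    rw [← h2]
    abel
  · intro x
    rw [hA]
    have := hI2 (Φ (G x))
    simp only [sub_apply, ContinuousLinearMap.id_apply, ContinuousLinearMap.comp_apply, map_add]
    rw [map_add] at this
    have h2 := congrArg J this
    rw [map_add] at h2
    have e : x + J (Φ (G x)) - (J (I (Φ (G x))) + J (I (Φ (G (J (Φ (G x))))))) = x := by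
      rw [h2, add_sub_cancel_right]
    exact Eq.trans (by abel) e

/-- A kernel vector `v` yields the eigenvector `G (J v)`: the relation `Φ (G (J v)) = -v` cancels
the finite-rank term, and it also prevents `G (J v)` from vanishing. -/
theorem isEigenvalueOp_of_det_eq_zero (h : IsInverseOfAdd T (shiftPerturbation J Φ l) G)
    (hd : (reducedMatrix J Φ G).det = 0) : IsEigenvalueOp T l := by
  obtain ⟨v, hv, hN⟩ := Matrix.exists_mulVec_eq_zero_iff.2 hd
  rw [reducedMatrix_mulVec] at hN
  have hg := h.1 (J v)
  have hΦ : Φ (G (J v)) = -v := (neg_eq_of_add_eq_zero_right hN).symm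
  obtain ⟨y, hy1, hy2⟩ := (LinearPMap.mem_graph_iff T).1 hg
  simp only at hy1 hy2
  refine ⟨y, ?_, ?_⟩
  · rintro rfl
    rw [← hy1] at hΦ
    simp at hΦ
    exact hv hΦ
  · rw [hy2, hy1, shiftPerturbation_apply, hΦ, map_neg]
    abel

theorem not_mem_resolventSetOp_of_isEigenvalueOp (h : IsEigenvalueOp T l) :
    l ∉ resolventSetOp T := by
  rintro ⟨R, -, hR⟩
  obtain ⟨x, hx, hTx⟩ := h
  apply hx
  have h0 : shiftedOperator T l x = 0 := by
    change T x - l • (x : X) = 0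
    rw [hTx, sub_self]
  have := hR x
  rw [h0, map_zero] at this
  exact Subtype.ext this.symm

theorem mem_resolventSetOp_iff_det_ne_zero (h : IsInverseOfAdd T (shiftPerturbation J Φ l) G) :
    l ∈ resolventSetOp T ↔ (reducedMatrix J Φ G).det ≠ 0 :=
  ⟨fun hl hd => not_mem_resolventSetOp_of_isEigenvalueOp (isEigenvalueOp_of_det_eq_zero h hd) hl,
    mem_resolventSetOp_of_det_ne_zero h⟩

/-- Since `(T - l) G y = y + J (Φ (G y))`, the range contains the kernel of `Φ G`, which has finite
codimension. -/
theorem finiteDimensional_coker (h : IsInverseOfAdd T (shiftPerturbation J Φ l) G) :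
    FiniteDimensional ℂ (X ⧸ LinearMap.range (shiftedOperator T l)) := by
  let Ψ : X →ₗ[ℂ] (Fin n → ℂ) := (Φ ∘L G : X →L[ℂ] (Fin n → ℂ))
  have hle : LinearMap.ker Ψ ≤ LinearMap.range (shiftedOperator T l) := by
    intro y hy
    have hy' : Φ (G y) = 0 := hy
    obtain ⟨x, hx1, hx2⟩ := (LinearPMap.mem_graph_iff T).1 (h.1 y)
    simp only at hx1 hx2
    refine ⟨x, ?_⟩
    change T x - l • (x : X) = y
    rw [hx2, hx1, shiftPerturbation_apply, hy', map_zero]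
    abel
  have : FiniteDimensional ℂ (X ⧸ LinearMap.ker Ψ) :=
    Module.Finite.equiv Ψ.quotKerEquivRange.symm
  exact Module.Finite.of_surjective (Submodule.factor hle) (Submodule.factor_surjective hle)

/-- If `(T - l) x = y` then `x = G y - G (J (Φ x))`, so each further power adds at most `n`
dimensions. This bound grows with `m`; stabilization comes from the determinant. -/
theorem finiteDimensional_genKer (h : IsInverseOfAdd T (shiftPerturbation J Φ l) G) (m : ℕ) :
    FiniteDimensional ℂ (genKer T l m) := by
  induction m with
  | zero => exact inferInstanceAs (FiniteDimensional ℂ (⊥ : Submodule ℂ X))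
  | succ m ih =>
    let GJ : (Fin n → ℂ) →ₗ[ℂ] X := (G ∘L J : (Fin n → ℂ) →L[ℂ] X)
    have hle : genKer T l (m + 1) ≤
        LinearMap.range GJ ⊔ (genKer T l m).map (G : X →ₗ[ℂ] X) := by
      intro x hx
      obtain ⟨y, hy, hxy⟩ := mem_genKer_succ.1 hx
      have := h.2 _ hxy
      simp only [shiftPerturbation_apply] at this
      have hx' : x = GJ (-Φ x) + G y := by
        change x = G (J (-Φ x)) + G y
        rw [← map_add]
        nth_rewrite 1 [← this]
        congr 1
        rw [map_neg]
        abel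
      rw [hx']
      exact Submodule.add_mem_sup ⟨_, rfl⟩ ⟨y, hy, rfl⟩
    exact Submodule.finiteDimensional_of_le hle

end Reduction

/-! ### Analytic continuation of the reduced determinant and multiplicity of its zeros. -/

section Local

variable [CompleteSpace X] {T : X →ₗ.[ℂ] X} {n : ℕ} {J : (Fin n → ℂ) →L[ℂ] X}
  {Φ : X →L[ℂ] (Fin n → ℂ)} {G : X →L[ℂ] X} {l : ℂ}

/-- The continuation of the inverse `G` from `l` to `z` by the Neumann series. -/
noncomputable def inverseAt (G : X →L[ℂ] X) (l z : ℂ) : X →L[ℂ] X :=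
  G * Ring.inverse (1 - (z - l) • G)

theorem analyticAt_inverseAt (G : X →L[ℂ] X) (l : ℂ) : AnalyticAt ℂ (inverseAt G l) l := by
  have h1 : AnalyticAt ℂ (fun z : ℂ => 1 - (z - l) • G) l := by fun_prop
  have h2 : AnalyticAt ℂ (Ring.inverse : (X →L[ℂ] X) → X →L[ℂ] X) (1 - (l - l) • G) := by
    rw [sub_self, zero_smul, sub_zero]
    exact analyticAt_inverse (𝕜 := ℂ) (1 : (X →L[ℂ] X)ˣ)
  exact analyticAt_const.mul (AnalyticAt.comp (g := Ring.inverse) h2 h1)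

theorem eventually_isInverseOfAdd_inverseAt
    (h : IsInverseOfAdd T (shiftPerturbation J Φ l) G) :
    ∀ᶠ z in 𝓝 l, IsInverseOfAdd T (shiftPerturbation J Φ z) (inverseAt G l z) := by
  have hc : Continuous fun z : ℂ => ‖(z - l) • G‖ := by fun_prop
  have h1 : ∀ᶠ z in 𝓝 l, ‖(z - l) • G‖ < 1 :=
    hc.continuousAt.eventually_lt continuousAt_const (by simp)
  filter_upwards [h1] with z hz
  have e : 1 + (shiftPerturbation J Φ z - shiftPerturbation J Φ l) * G = 1 - (z - l) • G := by
    ext x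
    simp only [add_apply, sub_apply, mul_apply_eq_comp, shiftPerturbation_apply,
      smul_apply]
    module
  have := h.perturb_of_isUnit (A' := shiftPerturbation J Φ z)
    (by rw [e]; exact isUnit_one_sub_of_norm_lt_one hz)
  rwa [e] at this

theorem analyticAt_reducedMatrix_apply (J : (Fin n → ℂ) →L[ℂ] X) (Φ : X →L[ℂ] (Fin n → ℂ))
    (G : X →L[ℂ] X) (l : ℂ) (i j : Fin n) :
    AnalyticAt ℂ (fun z => reducedMatrix J Φ (inverseAt G l z) i j) l := by
  let Λ : (X →L[ℂ] X) →L[ℂ] ℂ :=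
    (ContinuousLinearMap.proj i ∘L Φ) ∘L (ContinuousLinearMap.apply ℂ X (J (Pi.single j 1)))
  have e : (fun z => reducedMatrix J Φ (inverseAt G l z) i j) =
      fun z => (1 : Matrix (Fin n) (Fin n) ℂ) i j + Λ (inverseAt G l z) := by
    funext z
    simp [reducedMatrix, Λ, LinearMap.toMatrix'_apply]
  rw [e]
  exact analyticAt_const.add ((Λ.analyticAt _).comp (analyticAt_inverseAt G l))

theorem analyticAt_det_reducedMatrix (J : (Fin n → ℂ) →L[ℂ] X) (Φ : X →L[ℂ] (Fin n → ℂ))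
    (G : X →L[ℂ] X) (l : ℂ) :
    AnalyticAt ℂ (fun z => (reducedMatrix J Φ (inverseAt G l z)).det) l := by
  simp only [Matrix.det_apply']
  refine Finset.analyticAt_fun_sum _ fun p _ => ?_
  refine analyticAt_const.mul ?_
  exact Finset.analyticAt_fun_prod _ fun i _ => analyticAt_reducedMatrix_apply J Φ G l _ _

/-- An analytic function vanishes identically near `l` or is nonzero on a punctured neighborhood;
resolvent points arbitrarily close to `l` exclude the first case. -/
theorem eventually_det_ne_zero_of_frequently
    (h : IsInverseOfAdd T (shiftPerturbation J Φ l) G)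
    (hf : ∃ᶠ z in 𝓝 l, z ∈ resolventSetOp T) :
    ∀ᶠ z in 𝓝[≠] l, (reducedMatrix J Φ (inverseAt G l z)).det ≠ 0 := by
  rcases (analyticAt_det_reducedMatrix J Φ G l).eventually_eq_zero_or_eventually_ne_zero
    with h0 | h0
  · refine absurd hf ?_
    rw [not_frequently]
    filter_upwards [h0, eventually_isInverseOfAdd_inverseAt h] with z hz hzi hzr
    exact (mem_resolventSetOp_iff_det_ne_zero hzi).1 hzr hz
  · exact h0

theorem eventually_mem_resolventSetOp_of_frequently
    (h : IsInverseOfAdd T (shiftPerturbation J Φ l) G)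
    (hf : ∃ᶠ z in 𝓝 l, z ∈ resolventSetOp T) :
    ∀ᶠ z in 𝓝[≠] l, z ∈ resolventSetOp T := by
  filter_upwards [eventually_det_ne_zero_of_frequently h hf,
    (eventually_isInverseOfAdd_inverseAt h).filter_mono nhdsWithin_le_nhds] with z hz hzi
  exact (mem_resolventSetOp_iff_det_ne_zero hzi).2 hz

omit [CompleteSpace X] in
theorem reducedMatrix_mulVec_chain_sum {z : ℂ} {Gz : X →L[ℂ] X}
    (h : IsInverseOfAdd T (shiftPerturbation J Φ z) Gz) {χ : ℕ → X} {m : ℕ} (h0 : χ 0 = 0)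
    (hχ : ∀ k < m, (χ (k + 1), χ k + l • χ (k + 1)) ∈ T.graph) :
    (reducedMatrix J Φ Gz).mulVec (Φ (∑ k ∈ Finset.range m, (z - l) ^ k • χ (k + 1))) =
      -((z - l) ^ m • Φ (Gz (χ m))) := by
  rw [reducedMatrix_mulVec]
  have := h.2 _ (chain_sum_mem_graph h0 hχ z)
  simp only [shiftPerturbation_apply] at this
  set y := ∑ k ∈ Finset.range m, (z - l) ^ k • χ (k + 1)
  have e : Gz (-((z - l) ^ m • χ m) - J (Φ y)) = y := by
    rw [← this]
    congr 1
    rw [this]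
    abel
  have e2 := congrArg Φ e
  simp only [map_sub, map_neg, map_smul] at e2
  nth_rewrite 1 [← e2]
  abel

/-- A Jordan chain that is longer than the order of the zero of the reduced determinant is
degenerate. -/
theorem chain_one_eq_zero (h : IsInverseOfAdd T (shiftPerturbation J Φ l) G) {m N : ℕ}
    {e : ℂ → ℂ} (he : ContinuousAt e l) (hel : e l ≠ 0)
    (hd : ∀ᶠ z in 𝓝 l, (reducedMatrix J Φ (inverseAt G l z)).det = (z - l) ^ N • e z)
    (hm : N < m) {χ : ℕ → X} (h0 : χ 0 = 0)
    (hχ : ∀ k < m, (χ (k + 1), χ k + l • χ (k + 1)) ∈ T.graph) : χ 1 = 0 := by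
  let M : ℂ → Matrix (Fin n) (Fin n) ℂ := fun z => reducedMatrix J Φ (inverseAt G l z)
  let y : ℂ → X := fun z => ∑ k ∈ Finset.range m, (z - l) ^ k • χ (k + 1)
  have hM : ContinuousAt M l := by
    refine continuousAt_pi.2 fun i => continuousAt_pi.2 fun j => ?_
    exact (analyticAt_reducedMatrix_apply J Φ G l i j).continuousAt
  have hadj : ContinuousAt (fun z => (M z).adjugate) l :=
    (Continuous.matrix_adjugate continuous_id).continuousAt.comp hM
  have hG : ContinuousAt (fun z => inverseAt G l z) l := (analyticAt_inverseAt G l).continuousAt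
  have hy : Continuous y := by fun_prop
  -- The adjugate replaces the matrix by its determinant `(z - l)^N e(z)`. After cancellation a
  -- positive power `(z - l)^(m - N)` survives and forces the limit to vanish.
  have key : ∀ᶠ z in 𝓝[≠] l, e z • Φ (y z) =
      -((z - l) ^ (m - N) • (M z).adjugate.mulVec (Φ (inverseAt G l z (χ m)))) := by
    filter_upwards [hd.filter_mono nhdsWithin_le_nhds, self_mem_nhdsWithin,
      (eventually_isInverseOfAdd_inverseAt h).filter_mono nhdsWithin_le_nhds] with z hz hzl hzi
    have hne : z - l ≠ 0 := sub_ne_zero.2 hzl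
    have e1 := congrArg (fun v => (M z).adjugate.mulVec v)
      (reducedMatrix_mulVec_chain_sum hzi h0 hχ)
    rw [Matrix.mulVec_mulVec, Matrix.adjugate_mul, hz, Matrix.smul_mulVec, Matrix.one_mulVec,
      Matrix.mulVec_neg, Matrix.mulVec_smul] at e1
    have hpow : (z - l) ^ m = (z - l) ^ N * (z - l) ^ (m - N) := by
      rw [← pow_add]; congr 1; omega
    rw [hpow, smul_eq_mul, mul_smul, mul_smul, ← smul_neg] at e1
    exact smul_right_injective _ (pow_ne_zero N hne) e1
  have hlim1 : Tendsto (fun z => e z • Φ (y z)) (𝓝[≠] l) (𝓝 (e l • Φ (y l))) :=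
    (he.smul (Φ.continuous.comp hy).continuousAt).tendsto.mono_left nhdsWithin_le_nhds
  have hlim2 : Tendsto (fun z => -((z - l) ^ (m - N) •
      (M z).adjugate.mulVec (Φ (inverseAt G l z (χ m))))) (𝓝[≠] l) (𝓝 0) := by
    have hc : ContinuousAt (fun z => -((z - l) ^ (m - N) •
        (M z).adjugate.mulVec (Φ (inverseAt G l z (χ m))))) l := by
      have h1 : ContinuousAt (fun z => Φ (inverseAt G l z (χ m))) l :=
        Φ.continuous.continuousAt.comp (hG.clm_apply continuousAt_const)
      have h2 : ContinuousAt
          (fun z => (M z).adjugate.mulVec (Φ (inverseAt G l z (χ m)))) l := by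
        have := (Continuous.matrix_mulVec (A := fun p : Matrix (Fin n) (Fin n) ℂ × (Fin n → ℂ) => p.1)
          (B := fun p => p.2) continuous_fst continuous_snd).continuousAt
          (x := ((M l).adjugate, Φ (inverseAt G l l (χ m))))
        exact ContinuousAt.comp₂ (f := fun p : Matrix (Fin n) (Fin n) ℂ × (Fin n → ℂ) =>
          p.1.mulVec p.2) this hadj h1
      have h3 : ContinuousAt (fun z : ℂ => (z - l) ^ (m - N)) l := by fun_prop
      exact (h3.smul h2).neg
    have := hc.tendsto.mono_left (nhdsWithin_le_nhds (s := {l}ᶜ))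
    rwa [sub_self, zero_pow (by omega), zero_smul, neg_zero] at this
  have hΦ : e l • Φ (y l) = 0 :=
    tendsto_nhds_unique (hlim1.congr' key) hlim2
  have hyl : y l = χ 1 := by
    simp only [y, sub_self]
    obtain ⟨k, rfl⟩ : ∃ k, m = k + 1 := ⟨m - 1, by omega⟩
    rw [Finset.sum_range_succ']
    simp
  have hΦ1 : Φ (χ 1) = 0 := by
    rw [← hyl]
    exact (smul_eq_zero.1 hΦ).resolve_left hel
  -- As `χ 0 = 0` and `Φ (χ 1) = 0`, the injective operator `T - l - J Φ` annihilates `χ 1`.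
  have := h.2 _ (hχ 0 (by omega))
  simp only [shiftPerturbation_apply, zero_add, h0, hΦ1, map_zero] at this
  rw [← this]
  simp

/-- Let `N` be the order of the zero. A chain longer than `N` has `χ 1 = 0`, so its index can be
shifted by one; hence the kernels stabilize at the power `N`. -/
theorem finiteDimensional_genEigenspaceOp (h : IsInverseOfAdd T (shiftPerturbation J Φ l) G)
    (hd : ∀ᶠ z in 𝓝[≠] l, (reducedMatrix J Φ (inverseAt G l z)).det ≠ 0) :
    FiniteDimensional ℂ (genEigenspaceOp T l) := by
  have han := analyticAt_det_reducedMatrix J Φ G l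
  obtain ⟨N, e, he, hel, hde⟩ := han.exists_eventuallyEq_pow_smul_nonzero_iff.2 (by
    intro h0
    obtain ⟨z, hz, hz'⟩ := (hd.and (h0.filter_mono nhdsWithin_le_nhds)).exists
    exact hz hz')
  have hstab (k : ℕ) : genKer T l (N + k) ≤ genKer T l N := by
    induction k with
    | zero => exact le_rfl
    | succ k ih =>
      refine le_trans ?_ ih
      intro x hx
      obtain ⟨χ, h0, hn, hχ⟩ := exists_chain_of_mem_genKer hx
      have h1 := chain_one_eq_zero h he.continuousAt hel hde (m := N + (k + 1)) (by omega) h0 hχ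
      rw [← hn]
      exact mem_genKer_of_chain (χ := fun k => χ (k + 1)) h1 fun j hj => hχ (j + 1) (by omega)
  have hle : genEigenspaceOp T l ≤ genKer T l N := by
    refine iSup_le fun k => ?_
    exact ((monotone_nat_of_le_succ (genKer_mono_succ T l)) (Nat.le_add_left k N)).trans (hstab k)
  have := finiteDimensional_genKer h N
  exact Submodule.finiteDimensional_of_le hle

end Local

/-- If on a connected open set `U` that meets the resolvent set the operator `T - l` is invertible
up to a bounded operator of finite rank, then `U` contains no point of the essential spectrum. -/
theorem disjoint_essentialSpectrumOp [CompleteSpace X] {T : X →ₗ.[ℂ] X} {U : Set ℂ}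
    (hUc : IsPreconnected U)
    (h : ∀ l ∈ U, ∃ (n : ℕ) (J : (Fin n → ℂ) →L[ℂ] X) (Φ : X →L[ℂ] (Fin n → ℂ)) (G : X →L[ℂ] X),
      IsInverseOfAdd T (shiftPerturbation J Φ l) G)
    (hne : (U ∩ resolventSetOp T).Nonempty) : Disjoint U (essentialSpectrumOp T) := by
  let V : Set ℂ := {l | ∀ᶠ z in 𝓝[≠] l, z ∈ resolventSetOp T}
  have hV : U ⊆ V := by
    -- The finite-rank data vary with `l`, so no single determinant is available on all of `U`.
    -- Instead `V` is open, meets `U` and is relatively closed in it.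
    refine hUc.subset_of_closure_inter_subset isOpen_setOfPred_eventually_nhdsWithin ?_ ?_
    · obtain ⟨l, hlU, hl⟩ := hne
      obtain ⟨n, J, Φ, G, hG⟩ := h l hlU
      refine ⟨l, hlU, eventually_mem_resolventSetOp_of_frequently hG ?_⟩
      intro hcon
      exact hcon.self_of_nhds hl
    · rintro l ⟨hlV, hlU⟩
      obtain ⟨n, J, Φ, G, hG⟩ := h l hlU
      refine eventually_mem_resolventSetOp_of_frequently hG ?_
      rw [frequently_iff]
      intro W hW
      obtain ⟨O, hOW, hO, hlO⟩ := mem_nhds_iff.1 hW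
      obtain ⟨z, hzO, hzV⟩ := mem_closure_iff.1 hlV O hO hlO
      have hzV' : ∀ᶠ w in 𝓝[≠] z, w ∈ resolventSetOp T := hzV
      obtain ⟨w, hw, hwO⟩ :=
        (hzV'.and ((hO.eventually_mem hzO).filter_mono nhdsWithin_le_nhds)).exists
      exact ⟨w, hOW hwO, hw⟩
  rw [Set.disjoint_left]
  rintro l hlU ⟨hls, hlp⟩
  apply hlp
  obtain ⟨n, J, Φ, G, hG⟩ := h l hlU
  have hlV : ∀ᶠ z in 𝓝[≠] l, z ∈ resolventSetOp T := hV hlU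
  refine ⟨?_, ?_, ?_, finiteDimensional_coker hG⟩
  · refine isEigenvalueOp_of_det_eq_zero hG ?_
    by_contra hd
    exact hls (mem_resolventSetOp_of_det_ne_zero hG hd)
  · rw [eventually_nhdsWithin_iff, Metric.eventually_nhds_iff] at hlV
    obtain ⟨r, hr, hr'⟩ := hlV
    refine ⟨r, hr, fun m hm hml => ?_⟩
    by_contra hne'
    exact hm (hr' (by rwa [dist_eq_norm]) hne')
  · refine finiteDimensional_genEigenspaceOp hG (eventually_det_ne_zero_of_frequently hG ?_)
    exact hlV.frequently.filter_mono nhdsWithin_le_nhds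

end AbstractSpectral

/-! ### Bounded solutions of scalar first- and second-order equations. -/

section ScalarODE

open MeasureTheory Set

/-- The solution is `-e^{t x} ∫_x^∞ e^{-t ξ} h(ξ) dξ`; integrating towards `+∞` keeps the kernel
decaying. -/
theorem exists_bounded_solution_of_re_pos {t : ℂ} (ht : 0 < t.re) {h : ℝ → ℂ} (hc : Continuous h)
    {H : ℝ} (hH : ∀ x, ‖h x‖ ≤ H) :
    ∃ y : ℝ → ℂ, (∀ x, HasDerivAt y (t * y x + h x) x) ∧ ∀ x, ‖y x‖ ≤ H / t.re := by
  let g : ℝ → ℂ := fun ξ => Complex.exp (-(t * ξ)) * h ξ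
  have hg : Continuous g := by fun_prop
  have hgn (ξ : ℝ) : ‖g ξ‖ ≤ H * Real.exp (-t.re * ξ) := by
    rw [norm_mul, Complex.norm_exp, mul_comm]
    simp only [Complex.neg_re, Complex.mul_re, Complex.ofReal_re, Complex.ofReal_im, mul_zero,
      sub_zero, neg_mul]
    exact mul_le_mul_of_nonneg_right (hH ξ) (Real.exp_pos _).le
  have hdom (x : ℝ) : IntegrableOn (fun ξ => H * Real.exp (-t.re * ξ)) (Ioi x) :=
    (integrableOn_exp_mul_Ioi (by linarith) x).const_mul H
  have hgi (x : ℝ) : IntegrableOn g (Ioi x) :=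
    (hdom x).mono' hg.aestronglyMeasurable (ae_of_all _ hgn)
  have hI (x : ℝ) : ∫ ξ in Ioi x, g ξ = (∫ ξ in Ioi 0, g ξ) - ∫ ξ in (0 : ℝ)..x, g ξ := by
    rw [← intervalIntegral.integral_interval_add_Ioi (hgi 0) (hgi x), add_sub_cancel_left]
  refine ⟨fun x => -(Complex.exp (t * x) * ∫ ξ in Ioi x, g ξ), fun x => ?_, fun x => ?_⟩
  · have h1 : HasDerivAt (fun x : ℝ => ∫ ξ in Ioi x, g ξ) (-g x) x := by
      rw [funext hI]
      exact (intervalIntegral.integral_hasDerivAt_right (hg.intervalIntegrable _ _)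
        (hg.stronglyMeasurableAtFilter _ _) hg.continuousAt).const_sub _
    have h2 : HasDerivAt (fun x : ℝ => Complex.exp (t * x)) (Complex.exp (t * x) * (t * 1)) x :=
      ((Complex.ofRealCLM.hasDerivAt (x := x)).const_mul t).cexp
    have h3 : Complex.exp (t * x) * Complex.exp (-(t * x)) = 1 := by
      rw [← Complex.exp_add, add_neg_cancel, Complex.exp_zero]
    refine (h2.mul h1).neg.congr_deriv ?_
    change -(Complex.exp (t * x) * (t * 1) * _ +
      Complex.exp (t * x) * -(Complex.exp (-(t * x)) * h x)) = _
    linear_combination (h x) * h3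
  · rw [norm_neg, norm_mul, Complex.norm_exp]
    simp only [Complex.mul_re, Complex.ofReal_re, Complex.ofReal_im, mul_zero, sub_zero]
    have h1 : ‖∫ ξ in Ioi x, g ξ‖ ≤ H * (Real.exp (-t.re * x) / t.re) := by
      refine (norm_integral_le_of_norm_le (hdom x) (ae_of_all _ hgn)).trans_eq ?_
      rw [integral_const_mul, integral_exp_mul_Ioi (by linarith)]
      rw [neg_div_neg_eq]
    refine (mul_le_mul_of_nonneg_left h1 (Real.exp_pos _).le).trans_eq ?_
    have h3 : Real.exp (t.re * x) * Real.exp (-t.re * x) = 1 := by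
      rw [← Real.exp_add, neg_mul, add_neg_cancel, Real.exp_zero]
    rw [div_eq_mul_inv, div_eq_mul_inv]
    linear_combination (H * t.re⁻¹) * h3

theorem exists_bounded_solution {t : ℂ} (ht : t.re ≠ 0) {h : ℝ → ℂ} (hc : Continuous h)
    {H : ℝ} (hH : ∀ x, ‖h x‖ ≤ H) :
    ∃ y : ℝ → ℂ, (∀ x, HasDerivAt y (t * y x + h x) x) ∧ ∀ x, ‖y x‖ ≤ H / |t.re| := by
  rcases lt_or_gt_of_ne ht with ht | ht
  · obtain ⟨w, hw, hwb⟩ := exists_bounded_solution_of_re_pos (t := -t) (by simpa using ht)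
      (h := fun x => -h (-x)) (by fun_prop) (H := H) (fun x => by simpa using hH (-x))
    refine ⟨fun x => w (-x), fun x => ?_, fun x => ?_⟩
    · refine ((hw (-x)).scomp x (hasDerivAt_neg x)).congr_deriv ?_
      rw [neg_neg, neg_one_smul]
      ring
    · rw [abs_of_neg ht]
      exact hwb (-x)
  · rw [abs_of_pos ht]
    exact exists_bounded_solution_of_re_pos ht hc hH

/-- The product `e^{-t x} y` is constant, so a nonzero solution grows exponentially at `+∞`. -/
theorem eq_zero_of_bounded_of_re_pos {t : ℂ} (ht : 0 < t.re) {y : ℝ → ℂ}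
    (hy : ∀ x, HasDerivAt y (t * y x) x) {C : ℝ} (hC : ∀ x, ‖y x‖ ≤ C) (x : ℝ) : y x = 0 := by
  have hconst : ∀ z : ℝ, Complex.exp (-(t * z)) * y z = Complex.exp (-(t * x)) * y x := by
    intro z
    have hd (ξ : ℝ) : HasDerivAt (fun ξ : ℝ => Complex.exp (-(t * ξ)) * y ξ) 0 ξ := by
      have h2 : HasDerivAt (fun x : ℝ => Complex.exp (-(t * x)))
          (Complex.exp (-(t * ξ)) * -(t * 1)) ξ :=
        ((Complex.ofRealCLM.hasDerivAt (x := ξ)).const_mul t).neg.cexp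
      exact (h2.mul (hy ξ)).congr_deriv (by ring)
    exact is_const_of_deriv_eq_zero (fun ξ => (hd ξ).differentiableAt) (fun ξ => (hd ξ).deriv) z x
  by_contra hne
  have hpos : 0 < ‖y x‖ := norm_pos_iff.2 hne
  have hb (z : ℝ) : Real.exp (t.re * (z - x)) * ‖y x‖ ≤ C := by
    refine le_trans (le_of_eq ?_) (hC z)
    have e : y z = Complex.exp (t * (z - x)) * y x := by
      have := congrArg (fun w => Complex.exp (t * z) * w) (hconst z)
      simp only [← mul_assoc, ← Complex.exp_add] at this
      rw [add_neg_cancel, Complex.exp_zero, one_mul] at this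
      rw [this]
      congr 2
      ring
    rw [e, norm_mul, Complex.norm_exp]
    simp
  have hlim : Tendsto (fun z => Real.exp (t.re * (z - x)) * ‖y x‖) atTop atTop := by
    refine Tendsto.atTop_mul_const hpos (Real.tendsto_exp_atTop.comp ?_)
    exact (tendsto_atTop_add_const_right _ (-x) tendsto_id).const_mul_atTop ht
  obtain ⟨z, hz⟩ := (hlim.eventually_gt_atTop C).exists
  exact absurd (hb z) (not_le.2 hz)

theorem eq_zero_of_bounded {t : ℂ} (ht : t.re ≠ 0) {y : ℝ → ℂ}
    (hy : ∀ x, HasDerivAt y (t * y x) x) {C : ℝ} (hC : ∀ x, ‖y x‖ ≤ C) (x : ℝ) : y x = 0 := by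
  rcases lt_or_gt_of_ne ht with ht | ht
  · have := eq_zero_of_bounded_of_re_pos (t := -t) (by simpa using ht) (y := fun x => y (-x))
      (fun x => by
        refine ((hy (-x)).scomp x (hasDerivAt_neg x)).congr_deriv ?_
        rw [neg_one_smul, neg_mul]) (fun x => hC (-x)) (-x)
    simpa using this
  · exact eq_zero_of_bounded_of_re_pos ht hy hC x

/-- As `c` is real, the imaginary parts are opposite, and the left side equals `-Re s - (Im t₁)²`.
-/
theorem re_mul_re_of_sum_prod {c : ℝ} {s t₁ t₂ : ℂ} (hsum : t₁ + t₂ = -c) (hprod : t₁ * t₂ = -s) :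
    t₁.re * t₂.re ≤ -s.re := by
  have h1 := congrArg Complex.im hsum
  have h2 := congrArg Complex.re hprod
  simp only [Complex.add_im, Complex.neg_im, Complex.ofReal_im, neg_zero, Complex.mul_re,
    Complex.neg_re] at h1 h2
  have h3 : t₂.im = -t₁.im := by linarith
  rw [h3] at h2
  nlinarith [sq_nonneg t₁.im]

theorem exists_sum_prod (S Q : ℂ) : ∃ t₁ t₂ : ℂ, t₁ + t₂ = S ∧ t₁ * t₂ = Q := by
  obtain ⟨w, hw⟩ := IsAlgClosed.exists_pow_nat_eq (S ^ 2 - 4 * Q) (n := 2) (by norm_num)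
  exact ⟨(S + w) / 2, (S - w) / 2, by ring, by linear_combination -hw / 4⟩

theorem exists_roots_of_re_pos (c : ℝ) {s : ℂ} (hs : 0 < s.re) :
    ∃ t₁ t₂ : ℂ, t₁ + t₂ = -c ∧ t₁ * t₂ = -s ∧ t₁.re < 0 ∧ 0 < t₂.re := by
  obtain ⟨t₁, t₂, hsum, hprod⟩ := exists_sum_prod (-(c : ℂ)) (-s)
  have := re_mul_re_of_sum_prod hsum hprod
  rcases mul_neg_iff.1 (show t₁.re * t₂.re < 0 by linarith) with ⟨h1, h2⟩ | ⟨h1, h2⟩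
  · exact ⟨t₂, t₁, by rw [add_comm, hsum], by rw [mul_comm, hprod], h2, h1⟩
  · exact ⟨t₁, t₂, hsum, hprod, h1, h2⟩

/-- The operator factors as `(∂ - t₁)(∂ - t₂)` with roots off the imaginary axis, so two first-order
equations are solved in turn. The explicit constant `1 / s.re` for `y` is what later makes the
inverse small for large real `s`. -/
theorem exists_bounded_solution_second_order (c : ℝ) {s : ℂ} (hs : 0 < s.re) :
    ∃ C : ℝ, 0 ≤ C ∧ ∀ (h : ℝ → ℂ) (H : ℝ), Continuous h → (∀ x, ‖h x‖ ≤ H) →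
      ∃ y y₁ y₂ : ℝ → ℂ, (∀ x, HasDerivAt y (y₁ x) x) ∧ (∀ x, HasDerivAt y₁ (y₂ x) x) ∧
        (∀ x, y₂ x + c * y₁ x - s * y x = h x) ∧ (∀ x, ‖y x‖ ≤ H / s.re) ∧
        ∀ x, ‖y₁ x‖ ≤ C * H := by
  obtain ⟨t₁, t₂, hsum, hprod, h1, h2⟩ := exists_roots_of_re_pos c hs
  have hle := re_mul_re_of_sum_prod hsum hprod
  refine ⟨‖t₂‖ / s.re + 1 / |t₁.re|, by positivity, fun h H hc hH => ?_⟩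
  have hH0 : 0 ≤ H := (norm_nonneg _).trans (hH 0)
  obtain ⟨w, hw, hwb⟩ := exists_bounded_solution h1.ne hc hH
  have hwc : Continuous w := continuous_iff_continuousAt.2 fun x => (hw x).continuousAt
  obtain ⟨y, hy, hyb⟩ := exists_bounded_solution h2.ne' hwc hwb
  have hyb' (x : ℝ) : ‖y x‖ ≤ H / s.re := by
    refine (hyb x).trans ?_
    rw [div_div, ← abs_mul]
    refine div_le_div_of_nonneg_left hH0 hs ?_
    rw [abs_of_neg (by linarith)]
    linarith
  refine ⟨y, fun x => t₂ * y x + w x, fun x => t₂ * (t₂ * y x + w x) + (t₁ * w x + h x), hy,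
    fun x => ((hy x).const_mul t₂).add (hw x), fun x => ?_, hyb', fun x => ?_⟩
  · simp only
    linear_combination (t₂ * y x + w x) * hsum - (y x) * hprod
  · calc ‖t₂ * y x + w x‖ ≤ ‖t₂‖ * ‖y x‖ + ‖w x‖ := (norm_add_le _ _).trans (by rw [norm_mul])
      _ ≤ ‖t₂‖ * (H / s.re) + H / |t₁.re| :=
        add_le_add (mul_le_mul_of_nonneg_left (hyb' x) (norm_nonneg _)) (hwb x)
      _ = _ := by ring

theorem eq_zero_of_bounded_second_order (c : ℝ) {s : ℂ} (hs : 0 < s.re) {y y₁ y₂ : ℝ → ℂ}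
    (hy : ∀ x, HasDerivAt y (y₁ x) x) (hy₁ : ∀ x, HasDerivAt y₁ (y₂ x) x)
    (heq : ∀ x, y₂ x + c * y₁ x - s * y x = 0) {C : ℝ} (hC : ∀ x, ‖y x‖ ≤ C)
    (hC₁ : ∀ x, ‖y₁ x‖ ≤ C) (x : ℝ) : y x = 0 := by
  obtain ⟨t₁, t₂, hsum, hprod, h1, h2⟩ := exists_roots_of_re_pos c hs
  have hw (x : ℝ) : y₁ x - t₂ * y x = 0 := by
    refine eq_zero_of_bounded (t := t₁) (y := fun x => y₁ x - t₂ * y x) h1.ne (fun x => ?_)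
      (C := C + ‖t₂‖ * C) (fun x => ?_) x
    · refine ((hy₁ x).sub ((hy x).const_mul t₂)).congr_deriv ?_
      linear_combination heq x - (y₁ x) * hsum + (y x) * hprod
    · refine (norm_sub_le _ _).trans (add_le_add (hC₁ x) ?_)
      rw [norm_mul]
      exact mul_le_mul_of_nonneg_left (hC x) (norm_nonneg _)
  refine eq_zero_of_bounded (t := t₂) h2.ne' (fun x => ?_) hC x
  rw [← sub_eq_zero.1 (hw x)]
  exact hy x

end ScalarODE

/-! ### The constant-coefficient system and the signs of `μ₁`, `μ₂`. -/

section System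

/-- The row `(α, μ₁ - a)` is a left eigenvector of the Jacobian, so `r = α p + (μ₁ - a) q` solves a
scalar equation with `s = l - μ₁`. Then `q` solves one with `s = l - μ₂` and right side `k₂ - r`.
This triangular form also covers `μ₁ = μ₂`. -/
theorem exists_bounded_solution_system {a b σ α c : ℝ} (hα : 0 < α) {μ₁ μ₂ l : ℂ}
    (hsum : μ₁ + μ₂ = a + b) (hprod : μ₁ * μ₂ = a * b + σ * α)
    (h₁ : μ₁.re < l.re) (h₂ : μ₂.re < l.re) :
    ∃ C : ℝ, 0 ≤ C ∧ ∀ (k₁ k₂ : ℝ → ℂ) (H : ℝ), Continuous k₁ → Continuous k₂ →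
      (∀ x, ‖k₁ x‖ ≤ H) → (∀ x, ‖k₂ x‖ ≤ H) →
      ∃ p p₁ p₂ q q₁ q₂ : ℝ → ℂ,
        (∀ x, HasDerivAt p (p₁ x) x) ∧ (∀ x, HasDerivAt p₁ (p₂ x) x) ∧
        (∀ x, HasDerivAt q (q₁ x) x) ∧ (∀ x, HasDerivAt q₁ (q₂ x) x) ∧
        (∀ x, p₂ x + c * p₁ x + (a * p x - σ * q x) - l * p x = k₁ x) ∧
        (∀ x, q₂ x + c * q₁ x + (α * p x + b * q x) - l * q x = k₂ x) ∧
        (∀ x, ‖p x‖ ≤ C * H) ∧ (∀ x, ‖p₁ x‖ ≤ C * H) ∧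
        (∀ x, ‖q x‖ ≤ C * H) ∧ (∀ x, ‖q₁ x‖ ≤ C * H) := by
  have hs₁ : 0 < (l - μ₁).re := by simpa using h₁
  have hs₂ : 0 < (l - μ₂).re := by simpa using h₂
  obtain ⟨C₁, hC₁, hsol₁⟩ := exists_bounded_solution_second_order c hs₁
  obtain ⟨C₂, hC₂, hsol₂⟩ := exists_bounded_solution_second_order c hs₂
  have hα' : (α : ℂ) ≠ 0 := by exact_mod_cast hα.ne'
  set m : ℝ := ‖μ₁ - a‖ with hm
  have hm0 : 0 ≤ m := norm_nonneg _
  -- bounds for `r`, `r'`, `q`, `q'` in units of `H`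
  set B : ℝ := (α + m) / (l - μ₁).re with hB
  set B' : ℝ := C₁ * (α + m) with hB'
  set D : ℝ := (1 + B) / (l - μ₂).re with hD
  set D' : ℝ := C₂ * (1 + B) with hD'
  have hB0 : 0 ≤ B := by positivity
  have hB'0 : 0 ≤ B' := by positivity
  have hD0 : 0 ≤ D := by positivity
  have hD'0 : 0 ≤ D' := by positivity
  have hnorm (z w : ℂ) {Z W : ℝ} (hz : ‖z‖ ≤ Z) (hw : ‖w‖ ≤ W) :
      ‖(z - (μ₁ - a) * w) / α‖ ≤ (Z + m * W) / α := by
    rw [norm_div, Complex.norm_real, Real.norm_of_nonneg hα.le]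
    refine div_le_div_of_nonneg_right ((norm_sub_le _ _).trans (add_le_add hz ?_)) hα.le
    rw [norm_mul]
    exact mul_le_mul_of_nonneg_left hw hm0
  refine ⟨(B + m * D) / α + (B' + m * D') / α + D + D', by positivity,
    fun k₁ k₂ H hk₁ hk₂ hH₁ hH₂ => ?_⟩
  have hH0 : 0 ≤ H := (norm_nonneg _).trans (hH₁ 0)
  obtain ⟨r, r₁, r₂, hr, hr₁, hre, hrb, hrb₁⟩ := hsol₁ (fun x => α * k₁ x + (μ₁ - a) * k₂ x)
    ((α + m) * H) (by fun_prop) (fun x => by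
      refine (norm_add_le _ _).trans ?_
      rw [norm_mul, norm_mul, Complex.norm_real, Real.norm_of_nonneg hα.le, add_mul]
      exact add_le_add (mul_le_mul_of_nonneg_left (hH₁ x) hα.le)
        (mul_le_mul_of_nonneg_left (hH₂ x) hm0))
  have hrc : Continuous r := continuous_iff_continuousAt.2 fun x => (hr x).continuousAt
  have hrb' (x : ℝ) : ‖r x‖ ≤ B * H := (hrb x).trans_eq (by rw [hB]; ring)
  have hrb₁' (x : ℝ) : ‖r₁ x‖ ≤ B' * H := (hrb₁ x).trans_eq (by rw [hB']; ring)
  obtain ⟨q, q₁, q₂, hq, hq₁, hqe, hqb, hqb₁⟩ := hsol₂ (fun x => k₂ x - r x)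
    ((1 + B) * H) (by fun_prop) (fun x => by
      refine (norm_sub_le _ _).trans ?_
      rw [add_mul, one_mul]
      exact add_le_add (hH₂ x) (hrb' x))
  have hqb' (x : ℝ) : ‖q x‖ ≤ D * H := (hqb x).trans_eq (by rw [hD]; ring)
  have hqb₁' (x : ℝ) : ‖q₁ x‖ ≤ D' * H := (hqb₁ x).trans_eq (by rw [hD']; ring)
  refine ⟨fun x => (r x - (μ₁ - a) * q x) / α, fun x => (r₁ x - (μ₁ - a) * q₁ x) / α,
    fun x => (r₂ x - (μ₁ - a) * q₂ x) / α, q, q₁, q₂,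
    fun x => ((hr x).sub ((hq x).const_mul _)).div_const _,
    fun x => ((hr₁ x).sub ((hq₁ x).const_mul _)).div_const _, hq, hq₁,
    fun x => ?_, fun x => ?_, fun x => ?_, fun x => ?_, fun x => ?_, fun x => ?_⟩
  · have e1 := hre x
    have e2 := hqe x
    field_simp
    linear_combination e1 - (μ₁ - a) * e2 - a * q x * hsum + q x * hprod
  · have e2 := hqe x
    field_simp
    linear_combination e2 - q x * hsum
  · refine (hnorm _ _ (hrb' x) (hqb' x)).trans ?_
    have : (B * H + m * (D * H)) / α = (B + m * D) / α * H := by ring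
    rw [this]
    exact mul_le_mul_of_nonneg_right (by have : 0 ≤ (B' + m * D') / α := by positivity
                                         linarith) hH0
  · refine (hnorm _ _ (hrb₁' x) (hqb₁' x)).trans ?_
    have : (B' * H + m * (D' * H)) / α = (B' + m * D') / α * H := by ring
    rw [this]
    exact mul_le_mul_of_nonneg_right (by have : 0 ≤ (B + m * D) / α := by positivity
                                         linarith) hH0
  · refine (hqb' x).trans (mul_le_mul_of_nonneg_right ?_ hH0)
    have h1 : 0 ≤ (B + m * D) / α := by positivity
    have h2 : 0 ≤ (B' + m * D') / α := by positivity
    linarith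
  · refine (hqb₁' x).trans (mul_le_mul_of_nonneg_right ?_ hH0)
    have h1 : 0 ≤ (B + m * D) / α := by positivity
    have h2 : 0 ≤ (B' + m * D') / α := by positivity
    linarith

theorem eq_zero_of_bounded_system {a b σ α c : ℝ} (hα : 0 < α) {μ₁ μ₂ l : ℂ}
    (hsum : μ₁ + μ₂ = a + b) (hprod : μ₁ * μ₂ = a * b + σ * α)
    (h₁ : μ₁.re < l.re) (h₂ : μ₂.re < l.re) {p p₁ p₂ q q₁ q₂ : ℝ → ℂ}
    (hp : ∀ x, HasDerivAt p (p₁ x) x) (hp₁ : ∀ x, HasDerivAt p₁ (p₂ x) x)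
    (hq : ∀ x, HasDerivAt q (q₁ x) x) (hq₁ : ∀ x, HasDerivAt q₁ (q₂ x) x)
    (hpe : ∀ x, p₂ x + c * p₁ x + (a * p x - σ * q x) - l * p x = 0)
    (hqe : ∀ x, q₂ x + c * q₁ x + (α * p x + b * q x) - l * q x = 0)
    {C : ℝ} (hpb : ∀ x, ‖p x‖ ≤ C) (hpb₁ : ∀ x, ‖p₁ x‖ ≤ C) (hqb : ∀ x, ‖q x‖ ≤ C)
    (hqb₁ : ∀ x, ‖q₁ x‖ ≤ C) (x : ℝ) : p x = 0 ∧ q x = 0 := by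
  have hα' : (α : ℂ) ≠ 0 := by exact_mod_cast hα.ne'
  have hbound {z w : ℂ} (hz : ‖z‖ ≤ C) (hw : ‖w‖ ≤ C) :
      ‖α * z + (μ₁ - a) * w‖ ≤ α * C + ‖μ₁ - a‖ * C := by
    refine (norm_add_le _ _).trans ?_
    rw [norm_mul, norm_mul, Complex.norm_real, Real.norm_of_nonneg hα.le]
    exact add_le_add (mul_le_mul_of_nonneg_left hz hα.le)
      (mul_le_mul_of_nonneg_left hw (norm_nonneg _))
  have hr (x : ℝ) : α * p x + (μ₁ - a) * q x = 0 := by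
    refine eq_zero_of_bounded_second_order c (s := l - μ₁) (by simpa using h₁)
      (y := fun x => α * p x + (μ₁ - a) * q x) (y₁ := fun x => α * p₁ x + (μ₁ - a) * q₁ x)
      (y₂ := fun x => α * p₂ x + (μ₁ - a) * q₂ x)
      (fun x => ((hp x).const_mul _).add ((hq x).const_mul _))
      (fun x => ((hp₁ x).const_mul _).add ((hq₁ x).const_mul _)) (fun x => ?_)
      (fun x => hbound (hpb x) (hqb x)) (fun x => hbound (hpb₁ x) (hqb₁ x)) x
    linear_combination α * hpe x + (μ₁ - a) * hqe x + (μ₁ * q x) * hsum - q x * hprod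
  have hqz : q x = 0 := by
    refine eq_zero_of_bounded_second_order c (s := l - μ₂) (by simpa using h₂) hq hq₁
      (fun x => ?_) hqb hqb₁ x
    linear_combination hqe x - hr x + q x * hsum
  refine ⟨?_, hqz⟩
  have := hr x
  rw [hqz, mul_zero, add_zero] at this
  exact (mul_eq_zero.1 this).resolve_left hα'

/-- Real sum and product leave two cases: both numbers are real, or they share the real part `S /
2`. -/
theorem re_neg_of_sum_neg_of_prod_pos {S D : ℝ} (hS : S < 0) (hD : 0 < D) {μ₁ μ₂ : ℂ}
    (hsum : μ₁ + μ₂ = S) (hprod : μ₁ * μ₂ = D) : μ₁.re < 0 := by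
  have h1 := congrArg Complex.re hsum
  have h2 := congrArg Complex.im hsum
  have h3 := congrArg Complex.re hprod
  have h4 := congrArg Complex.im hprod
  simp only [Complex.add_re, Complex.add_im, Complex.mul_re, Complex.mul_im, Complex.ofReal_re,
    Complex.ofReal_im] at h1 h2 h3 h4
  have h5 : μ₂.im = -μ₁.im := by linarith
  rw [h5] at h3 h4
  by_contra hcon
  push Not at hcon
  have h6 : μ₁.im * (μ₂.re - μ₁.re) = 0 := by linarith
  rcases mul_eq_zero.1 h6 with h | h
  · rw [h] at h3
    nlinarith
  · linarith

end System

/-! ### The Banach space `BU`, its multiplication operators and evaluations. -/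

section BUSpace

theorem evalBU_add (P Q : BU) (z : ℝ) : evalBU (P + Q) z = evalBU P z + evalBU Q z := rfl

theorem evalBU_sub (P Q : BU) (z : ℝ) : evalBU (P - Q) z = evalBU P z - evalBU Q z := rfl

theorem evalBU_neg (P : BU) (z : ℝ) : evalBU (-P) z = -evalBU P z := rfl

theorem evalBU_smul (a : ℂ) (P : BU) (z : ℝ) : evalBU (a • P) z = a • evalBU P z := rfl

theorem norm_evalBU_le (P : BU) (z : ℝ) : ‖evalBU P z‖ ≤ ‖P‖ :=
  BoundedContinuousFunction.norm_coe_le_norm (P : ℝ →ᵇ ℂ × ℂ) z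

theorem BU_norm_nonneg (P : BU) : 0 ≤ ‖P‖ := norm_nonneg P

theorem BU_norm_le {P : BU} {C : ℝ} (hC : 0 ≤ C) (h : ∀ z, ‖evalBU P z‖ ≤ C) : ‖P‖ ≤ C :=
  (BoundedContinuousFunction.norm_le hC).2 h

theorem BU_ext {P Q : BU} (h : ∀ z, evalBU P z = evalBU Q z) : P = Q :=
  Subtype.ext (BoundedContinuousFunction.ext h)

theorem uniformContinuous_evalBU (P : BU) : UniformContinuous (evalBU P) := P.2

theorem exists_BU {P : ℝ → ℂ × ℂ} (hP : UniformContinuous P) {C : ℝ} (hC : ∀ z, ‖P z‖ ≤ C) :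
    ∃ Q : BU, evalBU Q = P :=
  ⟨⟨BoundedContinuousFunction.ofNormedAddCommGroup P hP.continuous C hC, hP⟩, rfl⟩

instance : CompleteSpace BU := by
  have hcl : IsClosed (BU : Set (ℝ →ᵇ ℂ × ℂ)) := by
    refine IsSeqClosed.isClosed fun F P hF hFP => ?_
    have h := BoundedContinuousFunction.tendsto_iff_tendstoUniformly.1 hFP
    exact h.uniformContinuous (Frequently.of_forall hF)
  exact hcl.completeSpace_coe

theorem norm_sub_le_of_hasDerivAt {P P₁ : ℝ → ℂ × ℂ} (h : ∀ z, HasDerivAt P (P₁ z) z) {C : ℝ}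
    (hC : ∀ z, ‖P₁ z‖ ≤ C) (x y : ℝ) : ‖P x - P y‖ ≤ C * |x - y| :=
  Convex.norm_image_sub_le_of_norm_hasDerivWithin_le (s := Set.univ)
    (fun z _ => (h z).hasDerivWithinAt) (fun z _ => hC z) convex_univ trivial trivial

theorem uniformContinuous_of_norm_sub_le {P : ℝ → ℂ × ℂ} {C : ℝ}
    (hC : ∀ x y, ‖P x - P y‖ ≤ C * |x - y|) : UniformContinuous P := by
  have : LipschitzWith C.toNNReal P := LipschitzWith.of_dist_le_mul fun x y => by
    rw [dist_eq_norm, Real.dist_eq]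
    exact (hC x y).trans (mul_le_mul_of_nonneg_right (Real.le_coe_toNNReal C) (abs_nonneg _))
  exact this.uniformContinuous

theorem exists_BU_of_hasDerivAt {P P₁ : ℝ → ℂ × ℂ} (h : ∀ z, HasDerivAt P (P₁ z) z) {C C₁ : ℝ}
    (hC : ∀ z, ‖P z‖ ≤ C) (hC₁ : ∀ z, ‖P₁ z‖ ≤ C₁) : ∃ Q : BU, evalBU Q = P :=
  exists_BU (uniformContinuous_of_norm_sub_le (norm_sub_le_of_hasDerivAt h hC₁)) hC

/-- Multiplication by a bounded uniformly continuous matrix function. -/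
theorem exists_mulBU {B : ℝ → (ℂ × ℂ →L[ℂ] ℂ × ℂ)} (hB : UniformContinuous B) {C : ℝ}
    (hC : ∀ z, ‖B z‖ ≤ C) :
    ∃ A : BU →L[ℂ] BU, ∀ P z, evalBU (A P) z = B z (evalBU P z) := by
  have hC0 : 0 ≤ C := (norm_nonneg _).trans (hC 0)
  have hle (P : BU) (z : ℝ) : ‖B z (evalBU P z)‖ ≤ C * ‖P‖ :=
    ((B z).le_opNorm _).trans (mul_le_mul (hC z) (norm_evalBU_le P z) (norm_nonneg _) hC0)
  have huc (P : BU) : UniformContinuous fun z => B z (evalBU P z) := by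
    rw [Metric.uniformContinuous_iff]
    intro ε hε
    obtain ⟨δ₁, hδ₁, h₁⟩ := Metric.uniformContinuous_iff.1 hB (ε / (2 * (‖P‖ + 1))) (by positivity)
    obtain ⟨δ₂, hδ₂, h₂⟩ := Metric.uniformContinuous_iff.1 (uniformContinuous_evalBU P)
      (ε / (2 * (C + 1))) (by positivity)
    refine ⟨min δ₁ δ₂, lt_min hδ₁ hδ₂, fun a b hab => ?_⟩
    have e₁ := h₁ (hab.trans_le (min_le_left _ _))
    have e₂ := h₂ (hab.trans_le (min_le_right _ _))
    rw [dist_eq_norm] at e₁ e₂ ⊢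
    have split : B a (evalBU P a) - B b (evalBU P b) =
        (B a - B b) (evalBU P a) + B b (evalBU P a - evalBU P b) := by
      rw [sub_apply, map_sub]; abel
    rw [split]
    have n₁ : ‖(B a - B b) (evalBU P a)‖ ≤ ε / (2 * (‖P‖ + 1)) * ‖P‖ :=
      ((B a - B b).le_opNorm _).trans
        (mul_le_mul e₁.le (norm_evalBU_le P a) (norm_nonneg _) (by positivity))
    have n₂ : ‖B b (evalBU P a - evalBU P b)‖ ≤ C * (ε / (2 * (C + 1))) :=
      ((B b).le_opNorm _).trans (mul_le_mul (hC b) e₂.le (norm_nonneg _) hC0)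
    have n₃ : ε / (2 * (‖P‖ + 1)) * ‖P‖ < ε / 2 := by
      rw [div_mul_eq_mul_div, div_lt_div_iff₀ (by positivity) (by positivity)]
      nlinarith [norm_nonneg P]
    have n₄ : C * (ε / (2 * (C + 1))) < ε / 2 := by
      rw [mul_div_assoc', div_lt_div_iff₀ (by positivity) (by positivity)]
      nlinarith
    linarith [norm_add_le ((B a - B b) (evalBU P a)) (B b (evalBU P a - evalBU P b))]
  choose A hA using fun P => exists_BU (huc P) (hle P)
  have hA' (P : BU) (z : ℝ) : evalBU (A P) z = B z (evalBU P z) := congrFun (hA P) z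
  let A' : BU →ₗ[ℂ] BU :=
    { toFun := A
      map_add' := fun P Q => BU_ext fun z => by
        rw [evalBU_add, hA', hA', hA', evalBU_add, map_add]
      map_smul' := fun a P => BU_ext fun z => by
        rw [RingHom.id_apply, evalBU_smul, hA', hA', evalBU_smul, map_smul] }
  have hb (P : BU) : ‖A' P‖ ≤ C * ‖P‖ :=
    BU_norm_le (mul_nonneg hC0 (BU_norm_nonneg P)) fun z => (hA' P z).symm ▸ hle P z
  let A'' : BU →L[ℂ] BU := LinearMap.mkContinuous (𝕜 := ℂ) (E := BU) (F := BU) (σ := RingHom.id ℂ) A' C hb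
  exact ⟨A'', hA'⟩

/-- Finite linear combinations, with coefficients in `ℂ²`, of bounded uniformly continuous
functions. -/
theorem exists_sumBU {n : ℕ} {ψ : Fin n → ℝ → ℝ} (hψ : ∀ j, UniformContinuous (ψ j)) {C : ℝ}
    (hC : ∀ j z, |ψ j z| ≤ C) :
    ∃ J : (Fin n → ℂ × ℂ) →L[ℂ] BU, ∀ v z, evalBU (J v) z = ∑ j, (ψ j z : ℂ) • v j := by
  have huc (v : Fin n → ℂ × ℂ) : UniformContinuous fun z => ∑ j, (ψ j z : ℂ) • v j := by
    have h (j : Fin n) : UniformContinuous fun z => (ψ j z : ℂ) • v j := by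
      have hl : UniformContinuous fun r : ℝ => (r : ℂ) • v j :=
        ((ContinuousLinearMap.toSpanSingleton ℂ (v j)).restrictScalars ℝ ∘L
          Complex.ofRealCLM).uniformContinuous
      exact hl.comp (hψ j)
    have hs (s : Finset (Fin n)) : UniformContinuous fun z => ∑ j ∈ s, (ψ j z : ℂ) • v j := by
      classical
      induction s using Finset.induction_on with
      | empty => simpa using uniformContinuous_const
      | insert a s ha ih =>
        simp only [Finset.sum_insert ha]
        exact (h a).add ih
    exact hs _
  have hle (v : Fin n → ℂ × ℂ) (z : ℝ) : ‖∑ j, (ψ j z : ℂ) • v j‖ ≤ ∑ j, C * ‖v j‖ := by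
    refine (norm_sum_le _ _).trans (Finset.sum_le_sum fun j _ => ?_)
    rw [norm_smul, Complex.norm_real, Real.norm_eq_abs]
    exact mul_le_mul_of_nonneg_right (hC j z) (norm_nonneg _)
  choose J hJ using fun v => exists_BU (huc v) (hle v)
  have hJ' (v : Fin n → ℂ × ℂ) (z : ℝ) : evalBU (J v) z = ∑ j, (ψ j z : ℂ) • v j :=
    congrFun (hJ v) z
  let J' : (Fin n → ℂ × ℂ) →ₗ[ℂ] BU :=
    { toFun := J
      map_add' := fun v w => BU_ext fun z => by
        rw [evalBU_add, hJ', hJ', hJ', ← Finset.sum_add_distrib]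
        exact Finset.sum_congr rfl fun j _ => by rw [Pi.add_apply, smul_add]
      map_smul' := fun a v => BU_ext fun z => by
        rw [RingHom.id_apply, evalBU_smul, hJ', hJ', Finset.smul_sum]
        exact Finset.sum_congr rfl fun j _ => by rw [Pi.smul_apply, smul_comm] }
  let J'' : (Fin n → ℂ × ℂ) →L[ℂ] BU :=
    LinearMap.toContinuousLinearMap (𝕜 := ℂ) (E := Fin n → ℂ × ℂ) (F' := BU) J'
  exact ⟨J'', hJ'⟩

/-- Evaluation at a point as a bounded functional. -/
noncomputable def evalCLM (x : ℝ) : BU →L[ℂ] ℂ × ℂ :=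
  LinearMap.mkContinuous
    { toFun := fun P => evalBU P x
      map_add' := fun P Q => evalBU_add P Q x
      map_smul' := fun a P => evalBU_smul a P x } 1 fun P => by
        rw [one_mul]
        exact norm_evalBU_le P x

end BUSpace

/-! ### Finite-rank approximation by piecewise linear interpolation. -/

section Interpolation

/-- The ramp function, `s` truncated to `[0, 1]`. -/
noncomputable def ramp (s : ℝ) : ℝ := max 0 (min s 1)

/-- The piecewise linear hat function with support `[j - 1, j + 1]`. -/
noncomputable def hat (j : ℕ) (t : ℝ) : ℝ := ramp (t + 1 - j) - ramp (t - j)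

theorem ramp_mono : Monotone ramp := fun _ _ h => max_le_max le_rfl (min_le_min h le_rfl)

theorem ramp_nonneg (s : ℝ) : 0 ≤ ramp s := le_max_left _ _

theorem ramp_le_one (s : ℝ) : ramp s ≤ 1 := max_le zero_le_one (min_le_right _ _)

theorem ramp_of_nonpos {s : ℝ} (h : s ≤ 0) : ramp s = 0 :=
  max_eq_left ((min_le_left _ _).trans h)

theorem ramp_of_one_le {s : ℝ} (h : 1 ≤ s) : ramp s = 1 := by
  rw [ramp, min_eq_right h, max_eq_right zero_le_one]

theorem hat_nonneg (j : ℕ) (t : ℝ) : 0 ≤ hat j t := sub_nonneg.2 (ramp_mono (by linarith))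

theorem hat_le_one (j : ℕ) (t : ℝ) : hat j t ≤ 1 := by
  unfold hat
  linarith [ramp_le_one (t + 1 - j), ramp_nonneg (t - j)]

theorem hat_eq_zero {j : ℕ} {t : ℝ} (h : 1 ≤ |t - j|) : hat j t = 0 := by
  unfold hat
  rcases le_abs.1 h with h | h
  · rw [ramp_of_one_le h, ramp_of_one_le (by linarith), sub_self]
  · rw [ramp_of_nonpos (by linarith), ramp_of_nonpos (by linarith), sub_self]

/-- The sum telescopes. For `0 ≤ t ≤ n - 1` it equals `1`, so the hats form a partition of unity
there. -/
theorem sum_hat (n : ℕ) (t : ℝ) : ∑ j ∈ Finset.range n, hat j t = ramp (t + 1) - ramp (t + 1 - n) := by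
  have := Finset.sum_range_sub' (fun j : ℕ => ramp (t + 1 - j)) n
  simp only [Nat.cast_zero, sub_zero] at this
  rw [← this]
  refine Finset.sum_congr rfl fun j _ => ?_
  rw [hat]
  congr 2
  push_cast
  ring

theorem uniformContinuous_ramp : UniformContinuous ramp :=
  (LipschitzWith.const_max (LipschitzWith.min_const LipschitzWith.id 1) 0).uniformContinuous

theorem uniformContinuous_hat_comp (j : ℕ) (a b : ℝ) :
    UniformContinuous fun z => hat j (z * a + b) := by
  have h (e : ℝ) : UniformContinuous fun z : ℝ => z * a + e :=
    ((LinearMap.mulRight ℝ a).toContinuousLinearMap.uniformContinuous).add uniformContinuous_const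
  have h1 := uniformContinuous_ramp.comp (h (b + 1 - j))
  have h2 := uniformContinuous_ramp.comp (h (b - j))
  convert h1.sub h2 using 2 with z
  simp only [hat, Function.comp]
  congr 2 <;> ring

/-- Composed with a decaying multiplication operator, functions with a bounded Lipschitz constant
are approximated uniformly by interpolation at finitely many points. -/
theorem exists_finiteRank_approx {B : ℝ → (ℂ × ℂ →L[ℂ] ℂ × ℂ)} {C : ℝ} (hC : ∀ z, ‖B z‖ ≤ C)
    (h0 : Tendsto B (cocompact ℝ) (𝓝 0)) {A : BU →L[ℂ] BU}
    (hA : ∀ P z, evalBU (A P) z = B z (evalBU P z)) {ε : ℝ} (hε : 0 < ε) :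
    ∃ (n : ℕ) (J : (Fin n → ℂ × ℂ) →L[ℂ] BU) (Φ : BU →L[ℂ] (Fin n → ℂ × ℂ)),
      ∀ (P : BU) (Λ : ℝ), (∀ x y, ‖evalBU P x - evalBU P y‖ ≤ Λ * |x - y|) →
        ‖A P - J (Φ P)‖ ≤ ε * (‖P‖ + Λ) := by
  have hC0 : 0 ≤ C := (norm_nonneg _).trans (hC 0)
  obtain ⟨r, hr⟩ : ∃ r : ℝ, ∀ z, r < |z| → ‖B z‖ ≤ ε / 2 := by
    have h1 : ∀ᶠ z in cocompact ℝ, ‖B z‖ < ε / 2 :=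
      (h0.norm).eventually_lt tendsto_const_nhds (by simpa using half_pos hε)
    obtain ⟨K, hK, hKs⟩ := mem_cocompact.1 h1
    obtain ⟨r, hr⟩ := hK.isBounded.subset_closedBall 0
    refine ⟨r, fun z hz => le_of_lt (hKs fun hzK => ?_)⟩
    have := hr hzK
    rw [Metric.mem_closedBall, dist_zero_right, Real.norm_eq_abs] at this
    linarith
  -- The mesh width is chosen so that `C * h ≤ ε`; the `2 N + 1` nodes `h (j - N)` cover `[-N h, N
  -- h]`, outside which `‖B z‖ ≤ ε / 2`.
  set h : ℝ := ε / (C + 1) with hh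
  have hhpos : 0 < h := by positivity
  obtain ⟨N, hN⟩ := exists_nat_gt (r / h)
  have hNr : r < N * h := (div_lt_iff₀ hhpos).1 hN
  set n := 2 * N + 1 with hn
  obtain ⟨J, hJ⟩ := exists_sumBU (n := n) (ψ := fun j z => hat j (z * h⁻¹ + N))
    (fun j => uniformContinuous_hat_comp j _ _) (C := 1) (fun j z => by
      rw [abs_of_nonneg (hat_nonneg _ _)]
      exact hat_le_one _ _)
  let Φ : BU →L[ℂ] (Fin n → ℂ × ℂ) := ContinuousLinearMap.pi fun j => evalCLM (h * ((j : ℕ) - N))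
  refine ⟨n, A ∘L J, Φ, fun P Λ hΛ => ?_⟩
  have hΛ0 : 0 ≤ Λ := by
    have := (norm_nonneg _).trans (hΛ 1 0)
    simpa using this
  have hsum (z : ℝ) : ∑ j : Fin n, hat j (z * h⁻¹ + N) =
      ramp (z * h⁻¹ + N + 1) - ramp (z * h⁻¹ + N + 1 - n) := by
    rw [← sum_hat, Finset.sum_range]
  rw [ContinuousLinearMap.comp_apply, ← map_sub A]
  refine BU_norm_le (by positivity) fun z => ?_
  rw [hA, evalBU_sub, hJ]
  have hΦ (j : Fin n) : Φ P j = evalBU P (h * ((j : ℕ) - N)) := rfl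
  simp only [hΦ]
  -- Inside, the hats sum to `1` and only nodes within distance `h` of `z` contribute, with error at
  -- most `C Λ h`. Outside, `ε / 2` multiplies a difference of norm at most `2 ‖P‖`.
  by_cases hz : |z| ≤ N * h
  · obtain ⟨hz1, hz2⟩ := abs_le.1 hz
    have hs1 : ∑ j : Fin n, hat j (z * h⁻¹ + N) = 1 := by
      have e1 : -(N : ℝ) ≤ z * h⁻¹ := by
        rw [← div_eq_mul_inv, le_div_iff₀ hhpos]; linarith
      have e2 : z * h⁻¹ ≤ N := by
        rw [← div_eq_mul_inv, div_le_iff₀ hhpos]; exact hz2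
      rw [hsum, ramp_of_one_le (by linarith), ramp_of_nonpos (by rw [hn]; push_cast; linarith),
        sub_zero]
    have e : evalBU P z - ∑ j : Fin n, ((hat j (z * h⁻¹ + N) : ℝ) : ℂ) •
        evalBU P (h * ((j : ℕ) - N)) = ∑ j : Fin n, ((hat j (z * h⁻¹ + N) : ℝ) : ℂ) •
          (evalBU P z - evalBU P (h * ((j : ℕ) - N))) := by
      simp only [smul_sub, Finset.sum_sub_distrib]
      rw [← Finset.sum_smul, ← Complex.ofReal_sum, hs1, Complex.ofReal_one, one_smul]
    have hb : ‖∑ j : Fin n, ((hat j (z * h⁻¹ + N) : ℝ) : ℂ) •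
          (evalBU P z - evalBU P (h * ((j : ℕ) - N)))‖ ≤ Λ * h := by
      calc _ ≤ ∑ j : Fin n, hat j (z * h⁻¹ + N) * (Λ * h) := by
            refine (norm_sum_le _ _).trans (Finset.sum_le_sum fun j _ => ?_)
            rw [norm_smul, Complex.norm_real, Real.norm_of_nonneg (hat_nonneg _ _)]
            by_cases hj : 1 ≤ |z * h⁻¹ + N - ((j : ℕ) : ℝ)|
            · rw [hat_eq_zero hj, zero_mul, zero_mul]
            · refine mul_le_mul_of_nonneg_left ((hΛ _ _).trans ?_) (hat_nonneg _ _)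
              refine mul_le_mul_of_nonneg_left ?_ hΛ0
              have : z - h * ((j : ℕ) - N) = h * (z * h⁻¹ + N - (j : ℕ)) := by
                field_simp
                ring
              rw [this, abs_mul, abs_of_pos hhpos]
              nlinarith
        _ = Λ * h := by rw [← Finset.sum_mul, hs1, one_mul]
    rw [e]
    refine ((B z).le_opNorm _).trans ((mul_le_mul (hC z) hb (norm_nonneg _) hC0).trans ?_)
    have : C * h ≤ ε := by
      rw [hh, mul_div_assoc', div_le_iff₀ (by positivity)]
      nlinarith
    nlinarith [norm_nonneg P, mul_le_mul_of_nonneg_right this hΛ0]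
  · have hBz := hr z (hNr.trans (not_le.1 hz))
    have hsn : ‖∑ j : Fin n, ((hat j (z * h⁻¹ + N) : ℝ) : ℂ) • evalBU P (h * ((j : ℕ) - N))‖ ≤
        ‖P‖ := by
      calc _ ≤ ∑ j : Fin n, hat j (z * h⁻¹ + N) * ‖P‖ := by
            refine (norm_sum_le _ _).trans (Finset.sum_le_sum fun j _ => ?_)
            rw [norm_smul, Complex.norm_real, Real.norm_of_nonneg (hat_nonneg _ _)]
            exact mul_le_mul_of_nonneg_left (norm_evalBU_le _ _) (hat_nonneg _ _)
        _ = (∑ j : Fin n, hat j (z * h⁻¹ + N)) * ‖P‖ := by rw [Finset.sum_mul]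
        _ ≤ 1 * ‖P‖ := by
            refine mul_le_mul_of_nonneg_right ?_ (BU_norm_nonneg P)
            rw [hsum]
            linarith [ramp_le_one (z * h⁻¹ + N + 1), ramp_nonneg (z * h⁻¹ + N + 1 - n)]
        _ = ‖P‖ := one_mul _
    have hb := (norm_sub_le (evalBU P z) (∑ j : Fin n, ((hat j (z * h⁻¹ + N) : ℝ) : ℂ) •
      evalBU P (h * ((j : ℕ) - N)))).trans (add_le_add (norm_evalBU_le P z) hsn)
    refine ((B z).le_opNorm _).trans
      ((mul_le_mul hBz hb (norm_nonneg _) (by positivity)).trans ?_)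
    nlinarith [norm_nonneg P, mul_nonneg hε.le hΛ0]

end Interpolation

/-! ### Bounded inverses from solvability and uniqueness. -/

section GeneralInverse

variable {X : Type*} [NormedAddCommGroup X] [NormedSpace ℂ X]

/-- Uniqueness makes the chosen solution linear in the right-hand side. The relation `S` transports
a further property of the solutions, later their Lipschitz estimate. -/
theorem exists_isInverseOfAdd {T : X →ₗ.[ℂ] X} {A : X →L[ℂ] X} {C : ℝ} {S : X → X → Prop}
    (hex : ∀ x, ∃ y, (y, x - A y) ∈ T.graph ∧ ‖y‖ ≤ C * ‖x‖ ∧ S x y)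
    (huniq : ∀ y, (y, -A y) ∈ T.graph → y = 0) :
    ∃ R, IsInverseOfAdd T A R ∧ (∀ x, ‖R x‖ ≤ C * ‖x‖) ∧ ∀ x, S x (R x) := by
  choose R hR hRb hRS using hex
  have huniq' {x y y' : X} (h : (y, x - A y) ∈ T.graph) (h' : (y', x - A y') ∈ T.graph) :
      y = y' := by
    refine sub_eq_zero.1 (huniq _ ?_)
    convert T.graph.sub_mem h h' using 1
    rw [Prod.mk_sub_mk, map_sub]
    congr 1
    abel
  let R' : X →ₗ[ℂ] X :=
    { toFun := R
      map_add' := fun x y => huniq' (hR _) (by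
        convert T.graph.add_mem (hR x) (hR y) using 1
        rw [Prod.mk_add_mk, map_add]
        congr 1
        abel)
      map_smul' := fun a x => huniq' (hR _) (by
        convert T.graph.smul_mem a (hR x) using 1
        rw [Prod.smul_mk, RingHom.id_apply, map_smul, smul_sub]) }
  refine ⟨R'.mkContinuous C hRb, ⟨hR, fun p hp => ?_⟩, hRb, hRS⟩
  refine huniq' (x := p.2 + A p.1) (hR _) ?_
  rw [add_sub_cancel_right]
  exact hp

/-- Finite-rank operators factor through some `Fin n → ℂ`. -/
theorem exists_factor_through_pi {V : Type*} [NormedAddCommGroup V] [NormedSpace ℂ V]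
    [FiniteDimensional ℂ V] (J : V →L[ℂ] X) (Φ : X →L[ℂ] V) :
    ∃ (n : ℕ) (J' : (Fin n → ℂ) →L[ℂ] X) (Φ' : X →L[ℂ] (Fin n → ℂ)), J' ∘L Φ' = J ∘L Φ := by
  let e : V ≃L[ℂ] (Fin (Module.finrank ℂ V) → ℂ) :=
    ContinuousLinearEquiv.ofFinrankEq (by simp)
  refine ⟨_, J ∘L e.symm.toContinuousLinearMap, e.toContinuousLinearMap ∘L Φ, ?_⟩
  ext x
  simp

end GeneralInverse

/-! ### From differential equations to the graph of the linearized operator. -/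

section Linearization

/-- The Jacobian matrix of the reaction terms as a continuous linear map, in terms of its
diagonal entries. -/
noncomputable def jacobianCLM (σ α a b : ℝ) : ℂ × ℂ →L[ℂ] ℂ × ℂ :=
  (((a : ℂ) • ContinuousLinearMap.fst ℂ ℂ ℂ) - (σ : ℂ) • ContinuousLinearMap.snd ℂ ℂ ℂ).prod
    ((α : ℂ) • ContinuousLinearMap.fst ℂ ℂ ℂ + (b : ℂ) • ContinuousLinearMap.snd ℂ ℂ ℂ)

theorem jacobianCLM_apply (σ α a b : ℝ) (w : ℂ × ℂ) :
    jacobianCLM σ α a b w = ((a : ℂ) * w.1 - σ * w.2, α * w.1 + b * w.2) := rfl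

theorem jacobianAction_eq (f g : ℝ → ℝ) (σ α u v : ℝ) (w : ℂ × ℂ) :
    jacobianAction f g σ α u v w = jacobianCLM σ α (deriv f u) (deriv g v) w := rfl

theorem continuous_jacobianCLM (σ α : ℝ) :
    Continuous fun p : ℝ × ℝ => jacobianCLM σ α p.1 p.2 := by
  have e : (fun p : ℝ × ℝ => jacobianCLM σ α p.1 p.2) = fun p : ℝ × ℝ =>
      (p.1 : ℂ) • (ContinuousLinearMap.inl ℂ ℂ ℂ ∘L ContinuousLinearMap.fst ℂ ℂ ℂ) +
      (p.2 : ℂ) • (ContinuousLinearMap.inr ℂ ℂ ℂ ∘L ContinuousLinearMap.snd ℂ ℂ ℂ) +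
      jacobianCLM σ α 0 0 := by
    funext p
    refine ContinuousLinearMap.ext fun w => ?_
    simp only [jacobianCLM_apply, add_apply, smul_apply, ContinuousLinearMap.comp_apply,
      ContinuousLinearMap.coe_fst', ContinuousLinearMap.coe_snd', ContinuousLinearMap.inl_apply,
      ContinuousLinearMap.inr_apply]
    ext <;> simp <;> ring
  rw [e]
  fun_prop

theorem isTravelingWave_tendsto {f g : ℝ → ℝ} {σ α c : ℝ} {u v : ℝ → ℝ}
    (h : IsTravelingWave f g σ α c u v) :
    Tendsto u (cocompact ℝ) (𝓝 0) ∧ Tendsto v (cocompact ℝ) (𝓝 0) := by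
  obtain ⟨C, η, hη, hd⟩ := h.decay
  have hlim : Tendsto (fun z : ℝ => C * Real.exp (-η * |z|)) (cocompact ℝ) (𝓝 0) := by
    have h1 : Tendsto (fun z : ℝ => |z|) (cocompact ℝ) atTop := tendsto_norm_cocompact_atTop
    have h2 : Tendsto (fun z : ℝ => Real.exp (-η * |z|)) (cocompact ℝ) (𝓝 0) :=
      Real.tendsto_exp_atBot.comp (h1.const_mul_atTop_of_neg (by linarith))
    simpa using h2.const_mul C
  exact ⟨squeeze_zero_norm (fun z => (hd z).1) hlim, squeeze_zero_norm (fun z => (hd z).2) hlim⟩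

variable {f g : ℝ → ℝ} {σ α c : ℝ} {u v : ℝ → ℝ}

/-- A bound on `P'` is enough: the equation expresses `P''` through bounded functions, so `P'` is
Lipschitz and lies in `BU`; the same equation then puts `P''` in `BU`. -/
theorem mem_graph_linearizedOperator {D : BU →L[ℂ] BU}
    (hD : ∀ P z, evalBU (D P) z = jacobianAction f g σ α (u z) (v z) (evalBU P z))
    {P Q : BU} {P₁ P₂ : ℝ → ℂ × ℂ} (h₁ : ∀ z, HasDerivAt (evalBU P) (P₁ z) z)
    (h₂ : ∀ z, HasDerivAt P₁ (P₂ z) z) {C : ℝ} (hC : ∀ z, ‖P₁ z‖ ≤ C)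
    (he : ∀ z, evalBU Q z = P₂ z + (c : ℂ) • P₁ z +
      jacobianAction f g σ α (u z) (v z) (evalBU P z)) :
    (P, Q) ∈ (linearizedOperator f g σ α c u v).graph := by
  rw [linearizedOperator_graph]
  have e (z : ℝ) : P₂ z = evalBU (Q - D P) z - (c : ℂ) • P₁ z := by
    rw [evalBU_sub, hD, he]; abel
  obtain ⟨P₁', rfl⟩ := exists_BU_of_hasDerivAt h₂ hC (C₁ := ‖Q - D P‖ + ‖(c : ℂ)‖ * C)
    (fun z => by
      rw [e]
      refine (norm_sub_le _ _).trans (add_le_add (norm_evalBU_le _ _) ?_)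
      rw [norm_smul]
      exact mul_le_mul_of_nonneg_left (hC z) (norm_nonneg _))
  refine ⟨P₁', Q - D P - (c : ℂ) • P₁', h₁, fun z => ?_, fun z => ?_⟩
  · rw [evalBU_sub, evalBU_smul, ← e]
    exact h₂ z
  · rw [evalBU_sub, evalBU_smul, ← e]
    exact he z

/-- Solvability with bounds of `P'' + c P' + N P - l P = Q` yields a bounded inverse of the
perturbation `L - (DF(u, v) - N) - l` of the linearized operator `L`. -/
theorem exists_inverse_of_solvable {D A : BU →L[ℂ] BU}
    (hD : ∀ P z, evalBU (D P) z = jacobianAction f g σ α (u z) (v z) (evalBU P z))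
    {N : ℂ × ℂ → ℂ × ℂ} (hA : ∀ P z, evalBU (A P) z = evalBU (D P) z - N (evalBU P z)) {l : ℂ}
    {C C' : ℝ} (hC : 0 ≤ C)
    (hex : ∀ Q : BU, ∃ P P₁ P₂ : ℝ → ℂ × ℂ, (∀ z, HasDerivAt P (P₁ z) z) ∧
      (∀ z, HasDerivAt P₁ (P₂ z) z) ∧
      (∀ z, P₂ z + (c : ℂ) • P₁ z + N (P z) - l • P z = evalBU Q z) ∧
      (∀ z, ‖P z‖ ≤ C * ‖Q‖) ∧ ∀ z, ‖P₁ z‖ ≤ C' * ‖Q‖)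
    (huniq : ∀ P P₁ P₂ : BU, (∀ z, HasDerivAt (evalBU P) (evalBU P₁ z) z) →
      (∀ z, HasDerivAt (evalBU P₁) (evalBU P₂ z) z) →
      (∀ z, evalBU P₂ z + (c : ℂ) • evalBU P₁ z + N (evalBU P z) - l • evalBU P z = 0) →
      ∀ z, evalBU P z = 0) :
    ∃ R, IsInverseOfAdd (linearizedOperator f g σ α c u v)
        (shiftSub (X := BU) A l) R ∧
      (∀ Q, ‖R Q‖ ≤ C * ‖Q‖) ∧
      ∀ Q x y, ‖evalBU (R Q) x - evalBU (R Q) y‖ ≤ C' * ‖Q‖ * |x - y| := by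
  refine exists_isInverseOfAdd (X := BU) (S := fun Q P =>
    ∀ x y, ‖evalBU P x - evalBU P y‖ ≤ C' * ‖Q‖ * |x - y|) (fun Q => ?_) (fun P hP => ?_)
  · obtain ⟨P, P₁, P₂, h₁, h₂, he, hPb, hPb₁⟩ := hex Q
    obtain ⟨P, rfl⟩ := exists_BU_of_hasDerivAt h₁ hPb hPb₁
    refine ⟨P, mem_graph_linearizedOperator hD h₁ h₂ hPb₁ fun z => ?_,
      BU_norm_le (mul_nonneg hC (BU_norm_nonneg Q)) hPb, norm_sub_le_of_hasDerivAt h₁ hPb₁⟩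
    simp only [shiftSub_apply, evalBU_sub, evalBU_neg, evalBU_smul]
    rw [← he, hA, hD]
    abel
  · rw [linearizedOperator_graph] at hP
    obtain ⟨P₁, P₂, h₁, h₂, he⟩ := hP
    refine BU_ext fun z => huniq P P₁ P₂ h₁ h₂ (fun z => ?_) z
    have := he z
    simp only [shiftSub_apply, evalBU_sub, evalBU_neg, evalBU_smul] at this
    rw [hA, hD] at this
    rw [← sub_eq_zero] at this
    rw [← neg_eq_zero, ← this]
    abel

end Linearization

/-! ### Neumann series criteria. -/

section GeneralInverse

variable {X : Type*} [NormedAddCommGroup X] [NormedSpace ℂ X]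

theorem exists_nonneg_bound (A : X →L[ℂ] X) : ∃ C : ℝ, 0 ≤ C ∧ ∀ x, ‖A x‖ ≤ C * ‖x‖ :=
  ⟨‖A‖, norm_nonneg _, A.le_opNorm⟩

theorem IsInverseOfAdd.mem_resolventSetOp [CompleteSpace X] {T : X →ₗ.[ℂ] X} {A R : X →L[ℂ] X}
    {l : ℂ} (h : IsInverseOfAdd T (shiftSub A l) R) {C ρ : ℝ} (hC : 0 ≤ C)
    (hA : ∀ x, ‖A x‖ ≤ C * ‖x‖) (hR : ∀ x, ‖R x‖ ≤ ρ * ‖x‖) (hlt : C * ρ < 1) :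
    l ∈ resolventSetOp T := by
  rw [mem_resolventSetOp_iff, ← shiftSub_zero]
  -- The maximum with `0` is needed because `ρ` has no assumed sign.
  refine h.exists_of_sub_le (k := max (C * ρ) 0) (le_max_right _ _) (max_lt hlt one_pos)
    fun x => ?_
  rw [zero_apply, sub_zero]
  refine (hA _).trans ((mul_le_mul_of_nonneg_left (hR x) hC).trans ?_)
  rw [← mul_assoc]
  exact mul_le_mul_of_nonneg_right (le_max_left _ _) (norm_nonneg _)

theorem IsInverseOfAdd.exists_of_finiteRank_approx [CompleteSpace X] {T : X →ₗ.[ℂ] X}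
    {A R : X →L[ℂ] X} {l : ℂ} (h : IsInverseOfAdd T (shiftSub A l) R) {V : Type*}
    [NormedAddCommGroup V] [NormedSpace ℂ V] [FiniteDimensional ℂ V] {J : V →L[ℂ] X}
    {Φ : X →L[ℂ] V} {k : ℝ} (hk0 : 0 ≤ k) (hk : k < 1)
    (hle : ∀ x, ‖A (R x) - J (Φ (R x))‖ ≤ k * ‖x‖) :
    ∃ (n : ℕ) (J : (Fin n → ℂ) →L[ℂ] X) (Φ : X →L[ℂ] (Fin n → ℂ)) (G : X →L[ℂ] X),
      IsInverseOfAdd T (shiftPerturbation J Φ l) G := by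
  obtain ⟨m, J', Φ', hJ'⟩ := exists_factor_through_pi J Φ
  obtain ⟨G, hG⟩ := h.exists_of_sub_le (A' := J ∘L Φ) hk0 hk hle
  refine ⟨m, J', Φ', G, ?_⟩
  rw [shiftPerturbation, hJ']
  exact hG

end GeneralInverse

/-! ### Eigenvalues of the asymptotic matrix. -/

section AsymptoticMatrix

/-- With `w = l - x² - c x` the value is `(w - a)(w - b) + σ α`, the characteristic polynomial of
the Jacobian at `w`, that is `(w - μ₁)(w - μ₂)`. Hence the splitting into two quadratics. -/
theorem eval_charpoly_asymptoticMatrix {a b σ α c : ℝ} (hσ : 0 < σ) (hα : 0 < α) (l x : ℂ) :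
    (asymptoticMatrix a b σ α c l).charpoly.eval x =
      (x ^ 2 + c * x + a - l) * (x ^ 2 + c * x + b - l) + σ * α := by
  have hσ' : (σ : ℂ) ≠ 0 := by exact_mod_cast hσ.ne'
  have hα' : (α : ℂ) ≠ 0 := by exact_mod_cast hα.ne'
  rw [Matrix.eval_charpoly]
  have e : Matrix.scalar (Fin 4) x - asymptoticMatrix a b σ α c l =
      !![x, 0, -(σ : ℂ), 0;
         0, x, 0, -(α : ℂ);
         -(l / σ - a / σ), -1, x + c, 0;
         1, -(l / α - b / α), 0, x + c] := by
    ext i j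
    fin_cases i <;> fin_cases j <;> simp [asymptoticMatrix]
  rw [e]
  simp [Matrix.det_succ_row_zero, Fin.sum_univ_succ, Fin.succAbove]
  field_simp
  ring

theorem roots_charpoly_asymptoticMatrix {a b σ α c : ℝ} (hσ : 0 < σ) (hα : 0 < α) {l : ℂ}
    {μ₁ μ₂ : ℂ} (hsum : μ₁ + μ₂ = a + b) (hprod : μ₁ * μ₂ = a * b + σ * α) {t₁ t₂ t₃ t₄ : ℂ}
    (h₁₂ : t₁ + t₂ = -c) (p₁₂ : t₁ * t₂ = -(l - μ₁)) (h₃₄ : t₃ + t₄ = -c)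
    (p₃₄ : t₃ * t₄ = -(l - μ₂)) :
    (asymptoticMatrix a b σ α c l).charpoly.roots = {t₁, t₂, t₃, t₄} := by
  have e : (asymptoticMatrix a b σ α c l).charpoly =
      (Multiset.map (fun t => Polynomial.X - Polynomial.C t) {t₁, t₂, t₃, t₄}).prod := by
    refine Polynomial.funext fun x => ?_
    rw [eval_charpoly_asymptoticMatrix hσ hα]
    simp only [Multiset.insert_eq_cons, Multiset.map_cons, Multiset.map_singleton,
      Multiset.prod_cons, Multiset.prod_singleton, Polynomial.eval_mul, Polynomial.eval_sub,
      Polynomial.eval_X, Polynomial.eval_C]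
    have q₁ : (x - t₁) * (x - t₂) = x ^ 2 + c * x - (l - μ₁) := by
      linear_combination p₁₂ - x * h₁₂
    have q₂ : (x - t₃) * (x - t₄) = x ^ 2 + c * x - (l - μ₂) := by
      linear_combination p₃₄ - x * h₃₄
    rw [← mul_assoc, q₁, q₂]
    linear_combination -(x ^ 2 + c * x - l) * hsum - hprod
  rw [e, Polynomial.roots_multiset_prod_X_sub_C]

theorem eigenvalueCount_asymptoticMatrix {a b σ α c : ℝ} (hσ : 0 < σ) (hα : 0 < α) {l : ℂ}
    {μ₁ μ₂ : ℂ} (hsum : μ₁ + μ₂ = a + b) (hprod : μ₁ * μ₂ = a * b + σ * α)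
    (h₁ : μ₁.re < l.re) (h₂ : μ₂.re < l.re) :
    eigenvalueCount (asymptoticMatrix a b σ α c l) {t : ℂ | 0 < t.re} = 2 ∧
      eigenvalueCount (asymptoticMatrix a b σ α c l) {t : ℂ | t.re < 0} = 2 := by
  obtain ⟨t₁, t₂, h₁₂, p₁₂, n₁, n₂⟩ := exists_roots_of_re_pos c (s := l - μ₁) (by simpa using h₁)
  obtain ⟨t₃, t₄, h₃₄, p₃₄, n₃, n₄⟩ := exists_roots_of_re_pos c (s := l - μ₂) (by simpa using h₂)
  unfold eigenvalueCount
  rw [roots_charpoly_asymptoticMatrix hσ hα hsum hprod h₁₂ p₁₂ h₃₄ p₃₄]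
  simp [Multiset.filter_singleton, n₁, n₂, n₃, n₄, n₁.le, n₂.le, n₃.le,
    n₄.le, not_lt.2]

end AsymptoticMatrix

/-! ### Inversion of the linearized operator modulo finite rank. -/

section Linearization

variable {f g : ℝ → ℝ} {σ α c : ℝ} {u v : ℝ → ℝ}

theorem hasDerivAt_fst {P P₁ : ℝ → ℂ × ℂ} (h : ∀ z, HasDerivAt P (P₁ z) z) (z : ℝ) :
    HasDerivAt (fun z => (P z).1) (P₁ z).1 z :=
  (ContinuousLinearMap.fst ℝ ℂ ℂ).hasFDerivAt.comp_hasDerivAt z (h z)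

theorem hasDerivAt_snd {P P₁ : ℝ → ℂ × ℂ} (h : ∀ z, HasDerivAt P (P₁ z) z) (z : ℝ) :
    HasDerivAt (fun z => (P z).2) (P₁ z).2 z :=
  (ContinuousLinearMap.snd ℝ ℂ ℂ).hasFDerivAt.comp_hasDerivAt z (h z)

theorem norm_evalBU_fst_le (P : BU) (z : ℝ) : ‖(evalBU P z).1‖ ≤ ‖P‖ :=
  (norm_fst_le _).trans (norm_evalBU_le P z)

theorem norm_evalBU_snd_le (P : BU) (z : ℝ) : ‖(evalBU P z).2‖ ≤ ‖P‖ :=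
  (norm_snd_le _).trans (norm_evalBU_le P z)

theorem continuous_evalBU_fst (P : BU) : Continuous fun z => (evalBU P z).1 :=
  continuous_fst.comp (uniformContinuous_evalBU P).continuous

theorem continuous_evalBU_snd (P : BU) : Continuous fun z => (evalBU P z).2 :=
  continuous_snd.comp (uniformContinuous_evalBU P).continuous

/-- The inverse of the operator with constant coefficients, to the right of its spectrum. -/
theorem exists_inverse_asymptotic {a b : ℝ} (hα : 0 < α) {μ₁ μ₂ l : ℂ}
    (hsum : μ₁ + μ₂ = a + b) (hprod : μ₁ * μ₂ = a * b + σ * α)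
    (h₁ : μ₁.re < l.re) (h₂ : μ₂.re < l.re) {D A : BU →L[ℂ] BU}
    (hD : ∀ P z, evalBU (D P) z = jacobianAction f g σ α (u z) (v z) (evalBU P z))
    (hA : ∀ P z, evalBU (A P) z = evalBU (D P) z - jacobianCLM σ α a b (evalBU P z)) :
    ∃ (R : BU →L[ℂ] BU) (C : ℝ), 0 ≤ C ∧
      IsInverseOfAdd (linearizedOperator f g σ α c u v) (shiftSub (X := BU) A l) R ∧
      (∀ Q, ‖R Q‖ ≤ C * ‖Q‖) ∧
      ∀ Q x y, ‖evalBU (R Q) x - evalBU (R Q) y‖ ≤ C * ‖Q‖ * |x - y| := by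
  obtain ⟨C, hC, hsol⟩ := exists_bounded_solution_system (c := c) hα hsum hprod h₁ h₂
  suffices h : ∃ R, IsInverseOfAdd (linearizedOperator f g σ α c u v) (shiftSub (X := BU) A l) R ∧
      (∀ Q, ‖R Q‖ ≤ C * ‖Q‖) ∧
      ∀ Q x y, ‖evalBU (R Q) x - evalBU (R Q) y‖ ≤ C * ‖Q‖ * |x - y| by
    obtain ⟨R, hR⟩ := h
    exact ⟨R, C, hC, hR⟩
  refine exists_inverse_of_solvable hD hA hC (fun Q => ?_) (fun P P₁ P₂ hP hP₁ he z => ?_)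
  · obtain ⟨p, p₁, p₂, q, q₁, q₂, hp, hp₁, hq, hq₁, hpe, hqe, hpb, hpb₁, hqb, hqb₁⟩ :=
      hsol (fun z => (evalBU Q z).1) (fun z => (evalBU Q z).2) ‖Q‖ (continuous_evalBU_fst Q)
        (continuous_evalBU_snd Q) (norm_evalBU_fst_le Q) (norm_evalBU_snd_le Q)
    refine ⟨fun z => (p z, q z), fun z => (p₁ z, q₁ z), fun z => (p₂ z, q₂ z),
      fun z => (hp z).prodMk (hq z), fun z => (hp₁ z).prodMk (hq₁ z),
      fun z => Prod.ext (hpe z) (hqe z), fun z => ?_, fun z => ?_⟩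
    · exact norm_prod_le_iff.2 ⟨hpb z, hqb z⟩
    · exact norm_prod_le_iff.2 ⟨hpb₁ z, hqb₁ z⟩
  · have := eq_zero_of_bounded_system (c := c) hα hsum hprod h₁ h₂
      (hasDerivAt_fst hP) (hasDerivAt_fst hP₁) (hasDerivAt_snd hP) (hasDerivAt_snd hP₁)
      (fun x => congrArg Prod.fst (he x)) (fun x => congrArg Prod.snd (he x))
      (C := max ‖P‖ ‖P₁‖) (fun x => (norm_evalBU_fst_le P x).trans (le_max_left _ _))
      (fun x => (norm_evalBU_fst_le P₁ x).trans (le_max_right _ _))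
      (fun x => (norm_evalBU_snd_le P x).trans (le_max_left _ _))
      (fun x => (norm_evalBU_snd_le P₁ x).trans (le_max_right _ _)) z
    exact Prod.ext this.1 this.2

theorem exists_bound_of_tendsto_cocompact {E : Type*} [NormedAddCommGroup E] {B : ℝ → E}
    (hc : Continuous B) (h0 : Tendsto B (cocompact ℝ) (𝓝 0)) : ∃ M, ∀ z, ‖B z‖ ≤ M := by
  have h1 : ∀ᶠ z in cocompact ℝ, ‖B z‖ < 1 :=
    (h0.norm).eventually_lt tendsto_const_nhds (by simp)
  obtain ⟨K, hK, hKs⟩ := mem_cocompact.1 h1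
  obtain ⟨M, hM⟩ := hK.exists_bound_of_continuousOn hc.continuousOn
  refine ⟨max M 1, fun z => ?_⟩
  by_cases hz : z ∈ K
  · exact (hM z hz).trans (le_max_left _ _)
  · exact (le_of_lt (hKs hz)).trans (le_max_right _ _)

/-- Real numbers that are large enough belong to the resolvent set. -/
theorem exists_gt_mem_resolventSetOp {D : BU →L[ℂ] BU}
    (hD : ∀ P z, evalBU (D P) z = jacobianAction f g σ α (u z) (v z) (evalBU P z)) (K : ℝ) :
    ∃ l : ℂ, K < l.re ∧ l ∈ resolventSetOp (X := BU) (linearizedOperator f g σ α c u v) := by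
  obtain ⟨C, hC, hDC⟩ := exists_nonneg_bound (X := BU) D
  -- All reaction terms are treated as a perturbation: `P'' + c P' - r P` has an inverse of norm at
  -- most `1 / r`, and `r` exceeds the bound `C` of `D`.
  set r : ℝ := max K 0 + C + 1 with hr
  have hr0 : 0 < r := by have := le_max_right K 0; linarith
  have hrK : K < r := by have := le_max_left K 0; linarith
  have hrC : C < r := by have := le_max_right K 0; linarith
  have hre : 0 < ((r : ℝ) : ℂ).re := hr0
  refine ⟨r, hrK, ?_⟩
  obtain ⟨C', hC', hsol⟩ := exists_bounded_solution_second_order c hre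
  suffices h : ∃ R, IsInverseOfAdd (linearizedOperator f g σ α c u v)
      (shiftSub (X := BU) D (r : ℂ)) R ∧ (∀ Q, ‖R Q‖ ≤ 1 / r * ‖Q‖) ∧
      ∀ Q x y, ‖evalBU (R Q) x - evalBU (R Q) y‖ ≤ C' * ‖Q‖ * |x - y| by
    obtain ⟨R, hR, hRb, -⟩ := h
    refine hR.mem_resolventSetOp (X := BU) hC hDC hRb ?_
    rw [mul_one_div, div_lt_one hr0]
    exact hrC
  refine exists_inverse_of_solvable hD (N := fun _ => 0) (fun P z => (sub_zero _).symm)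
    (by positivity) (fun Q => ?_) (fun P P₁ P₂ hP hP₁ he z => ?_)
  · obtain ⟨p, p₁, p₂, hp, hp₁, hpe, hpb, hpb₁⟩ := hsol _ ‖Q‖ (continuous_evalBU_fst Q)
      (norm_evalBU_fst_le Q)
    obtain ⟨q, q₁, q₂, hq, hq₁, hqe, hqb, hqb₁⟩ := hsol _ ‖Q‖ (continuous_evalBU_snd Q)
      (norm_evalBU_snd_le Q)
    have e : ‖Q‖ / ((r : ℝ) : ℂ).re = 1 / r * ‖Q‖ := by
      rw [Complex.ofReal_re]; ring
    rw [e] at hpb hqb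
    refine ⟨fun z => (p z, q z), fun z => (p₁ z, q₁ z), fun z => (p₂ z, q₂ z),
      fun z => (hp z).prodMk (hq z), fun z => (hp₁ z).prodMk (hq₁ z),
      fun z => ?_, fun z => ?_, fun z => ?_⟩
    · rw [add_zero]
      exact Prod.ext (hpe z) (hqe z)
    · exact norm_prod_le_iff.2 ⟨hpb z, hqb z⟩
    · exact norm_prod_le_iff.2 ⟨hpb₁ z, hqb₁ z⟩
  · simp only [add_zero] at he
    refine Prod.ext ?_ ?_
    · exact eq_zero_of_bounded_second_order c hre (hasDerivAt_fst hP) (hasDerivAt_fst hP₁)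
        (fun x => congrArg Prod.fst (he x)) (C := max ‖P‖ ‖P₁‖)
        (fun x => (norm_evalBU_fst_le P x).trans (le_max_left _ _))
        (fun x => (norm_evalBU_fst_le P₁ x).trans (le_max_right _ _)) z
    · exact eq_zero_of_bounded_second_order c hre (hasDerivAt_snd hP) (hasDerivAt_snd hP₁)
        (fun x => congrArg Prod.snd (he x)) (C := max ‖P‖ ‖P₁‖)
        (fun x => (norm_evalBU_snd_le P x).trans (le_max_left _ _))
        (fun x => (norm_evalBU_snd_le P₁ x).trans (le_max_right _ _)) z

/-- Up to an operator of finite rank, `L - l` is invertible to the right of the spectrum of the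
asymptotic operator. -/
theorem exists_inverse_mod_finiteRank {a b : ℝ} (hα : 0 < α) {μ₁ μ₂ l : ℂ}
    (hsum : μ₁ + μ₂ = a + b) (hprod : μ₁ * μ₂ = a * b + σ * α)
    (h₁ : μ₁.re < l.re) (h₂ : μ₂.re < l.re) {D A : BU →L[ℂ] BU}
    (hD : ∀ P z, evalBU (D P) z = jacobianAction f g σ α (u z) (v z) (evalBU P z))
    (hA : ∀ P z, evalBU (A P) z = evalBU (D P) z - jacobianCLM σ α a b (evalBU P z))
    {B : ℝ → (ℂ × ℂ →L[ℂ] ℂ × ℂ)} {M : ℝ} (hM : ∀ z, ‖B z‖ ≤ M)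
    (h0 : Tendsto B (cocompact ℝ) (𝓝 0)) (hAB : ∀ P z, evalBU (A P) z = B z (evalBU P z)) :
    ∃ (n : ℕ) (J : (Fin n → ℂ) →L[ℂ] BU) (Φ : BU →L[ℂ] (Fin n → ℂ)) (G : BU →L[ℂ] BU),
      IsInverseOfAdd (linearizedOperator f g σ α c u v) (shiftPerturbation (X := BU) J Φ l) G := by
  obtain ⟨R, C, hC, hR, hRb, hRl⟩ :=
    exists_inverse_asymptotic (c := c) hα hsum hprod h₁ h₂ hD hA
  -- Both `‖R Q‖` and the Lipschitz constant of `R Q` are at most `C ‖Q‖`, so this `ε` gives an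
  -- error of at most `‖Q‖ / 2`; the `+ 1` covers `C = 0`.
  have hε : 0 < 1 / (2 * (2 * C + 1)) := by positivity
  have hεC (q : ℝ) : 1 / (2 * (2 * C + 1)) * ((2 * C + 1) * q) = 1 / 2 * q := by
    field_simp
  obtain ⟨n, J, Φ, hJ⟩ := exists_finiteRank_approx hM h0 hAB hε
  refine hR.exists_of_finiteRank_approx (X := BU) (J := J) (Φ := Φ) (k := 1 / 2) (by norm_num)
    (by norm_num) fun Q => ?_
  refine (hJ (R Q) (C * ‖Q‖) (hRl Q)).trans (le_trans ?_ (hεC ‖Q‖).le)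
  refine mul_le_mul_of_nonneg_left ?_ hε.le
  linarith [hRb Q, BU_norm_nonneg Q]

theorem tendsto_jacobianCLM {ι : Type*} {F : Filter ι} {p q : ι → ℝ} {a b : ℝ}
    (hp : Tendsto p F (𝓝 a)) (hq : Tendsto q F (𝓝 b)) :
    Tendsto (fun z => jacobianCLM σ α (p z) (q z)) F (𝓝 (jacobianCLM σ α a b)) :=
  Tendsto.comp (g := fun r : ℝ × ℝ => jacobianCLM σ α r.1 r.2) (f := fun z => (p z, q z))
    ((continuous_jacobianCLM σ α).tendsto (a, b)) (hp.prodMk_nhds hq)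

/-- `D` is the whole reaction part and `A` its deviation from the rest state. The coefficients are
continuous with a limit at infinity, hence bounded and uniformly continuous, so multiplication by
them preserves `BU`. -/
theorem exists_coefficient_operators (hf : ContDiff ℝ 2 f) (hg : ContDiff ℝ 2 g)
    (hwave : IsTravelingWave f g σ α c u v) :
    ∃ (D A : BU →L[ℂ] BU) (B : ℝ → (ℂ × ℂ →L[ℂ] ℂ × ℂ)) (M : ℝ),
      (∀ P z, evalBU (D P) z = jacobianAction f g σ α (u z) (v z) (evalBU P z)) ∧
      (∀ P z, evalBU (A P) z =
        evalBU (D P) z - jacobianCLM σ α (deriv f 0) (deriv g 0) (evalBU P z)) ∧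
      (∀ z, ‖B z‖ ≤ M) ∧ Tendsto B (cocompact ℝ) (𝓝 0) ∧
      ∀ P z, evalBU (A P) z = B z (evalBU P z) := by
  obtain ⟨hu0, hv0⟩ := isTravelingWave_tendsto hwave
  have hf' : Continuous (deriv f) := hf.continuous_deriv (by norm_num)
  have hg' : Continuous (deriv g) := hg.continuous_deriv (by norm_num)
  have huc : Continuous u := hwave.contDiff_u.continuous
  have hvc : Continuous v := hwave.contDiff_v.continuous
  obtain ⟨N, hN⟩ : ∃ N : ℝ → (ℂ × ℂ →L[ℂ] ℂ × ℂ), ∀ z, N z =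
    jacobianCLM σ α (deriv f (u z)) (deriv g (v z)) := ⟨_, fun _ => rfl⟩
  obtain ⟨N₀, hN₀⟩ : ∃ N₀, N₀ = jacobianCLM σ α (deriv f 0) (deriv g 0) := ⟨_, rfl⟩
  have hNc : Continuous N := by
    rw [funext hN]
    exact continuous_iff_continuousAt.2 fun z =>
      tendsto_jacobianCLM ((hf'.comp huc).tendsto z) ((hg'.comp hvc).tendsto z)
  have hN0 : Tendsto N (cocompact ℝ) (𝓝 N₀) := by
    rw [funext hN, hN₀]
    exact tendsto_jacobianCLM ((hf'.tendsto 0).comp hu0) ((hg'.tendsto 0).comp hv0)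
  have hNuc : UniformContinuous N := hNc.uniformContinuous_of_tendsto_cocompact hN0
  have hB0 : Tendsto (fun z => N z - N₀) (cocompact ℝ) (𝓝 0) := by
    have := hN0.sub_const N₀
    rwa [sub_self] at this
  have hBc : Continuous fun z => N z - N₀ := hNc.sub continuous_const
  have hBuc : UniformContinuous fun z => N z - N₀ :=
    hBc.uniformContinuous_of_tendsto_cocompact hB0
  obtain ⟨M, hM⟩ := exists_bound_of_tendsto_cocompact hBc hB0
  have hMN (z : ℝ) : ‖N z‖ ≤ M + ‖N₀‖ := by
    have := norm_add_le (N z - N₀) N₀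
    rw [sub_add_cancel] at this
    exact this.trans (add_le_add (hM z) le_rfl)
  obtain ⟨D, hD⟩ := exists_mulBU hNuc hMN
  obtain ⟨A, hA⟩ := exists_mulBU hBuc hM
  refine ⟨D, A, fun z => N z - N₀, M, fun P z => ?_, fun P z => ?_, hM, hB0, hA⟩
  · rw [hD, hN, jacobianAction_eq]
  · rw [hA, hD, sub_apply, hN₀]

theorem disjoint_essentialSpectrumOp_linearizedOperator (hf : ContDiff ℝ 2 f) (hg : ContDiff ℝ 2 g)
    (hα : 0 < α) (hwave : IsTravelingWave f g σ α c u v) {μ₁ μ₂ : ℂ}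
    (hsum : μ₁ + μ₂ = (deriv f 0 : ℝ) + (deriv g 0 : ℝ))
    (hprod : μ₁ * μ₂ = (deriv f 0 : ℝ) * (deriv g 0 : ℝ) + σ * α) :
    Disjoint {l : ℂ | max μ₁.re μ₂.re < l.re}
      (essentialSpectrumOp (X := BU) (linearizedOperator f g σ α c u v)) := by
  obtain ⟨D, A, B, M, hD, hDA, hM, hB0, hAB⟩ := exists_coefficient_operators hf hg hwave
  refine disjoint_essentialSpectrumOp (X := BU) ?_ (fun l hl => ?_) ?_
  · exact (convex_halfSpace_re_gt _).isPreconnected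
  · exact exists_inverse_mod_finiteRank hα hsum hprod ((le_max_left _ _).trans_lt hl)
      ((le_max_right _ _).trans_lt hl) hD hDA hM hB0 hAB
  · exact exists_gt_mem_resolventSetOp hD _

end Linearization

theorem lemma2p1 (f g : ℝ → ℝ) (hf : ContDiff ℝ 2 f) (hg : ContDiff ℝ 2 g)
    (σ α c : ℝ) (hσ : 0 < σ) (hα : 0 < α)
    (htrace : deriv f 0 + deriv g 0 < 0)
    (hdet : 0 < deriv f 0 * deriv g 0 + σ * α)
    (u v : ℝ → ℝ) (hwave : IsTravelingWave f g σ α c u v) :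
    ∃ K : ℝ, K < 0 ∧
      essentialSpectrumOp (X := BU) (linearizedOperator f g σ α c u v) ⊆ {z : ℂ | z.re ≤ K} ∧
      ∀ l : ℂ, l ∉ {z : ℂ | z.re ≤ K} →
        eigenvalueCount (asymptoticMatrix (deriv f 0) (deriv g 0) σ α c l) {t : ℂ | 0 < t.re} = 2 ∧
        eigenvalueCount (asymptoticMatrix (deriv f 0) (deriv g 0) σ α c l) {t : ℂ | t.re < 0} = 2 := by
  obtain ⟨μ₁, μ₂, hsum, hprod⟩ := exists_sum_prod ((deriv f 0 : ℝ) + (deriv g 0 : ℝ))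
    ((deriv f 0 : ℝ) * (deriv g 0 : ℝ) + σ * α)
  have h₁ : μ₁.re < 0 := re_neg_of_sum_neg_of_prod_pos (μ₂ := μ₂) htrace hdet
    (by rw [hsum]; push_cast; rfl) (by rw [hprod]; push_cast; rfl)
  have h₂ : μ₂.re < 0 := re_neg_of_sum_neg_of_prod_pos (μ₂ := μ₁) htrace hdet
    (by rw [add_comm, hsum]; push_cast; rfl) (by rw [mul_comm, hprod]; push_cast; rfl)
  refine ⟨max μ₁.re μ₂.re, max_lt h₁ h₂, fun l hl => ?_, fun l hl => ?_⟩
  · by_contra hlK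
    exact Set.disjoint_left.1
      (disjoint_essentialSpectrumOp_linearizedOperator hf hg hα hwave hsum hprod)
      (not_le.1 hlK : max μ₁.re μ₂.re < l.re) hl
  · have hl' : max μ₁.re μ₂.re < l.re := not_le.1 hl
    exact eigenvalueCount_asymptoticMatrix hσ hα hsum hprod ((le_max_left _ _).trans_lt hl')
      ((le_max_right _ _).trans_lt hl')
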